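/- Let $PU(4)$ be the unitary group $U(4)$ modulo global phases, and let the gates $\mathrm{CZ} = \operatorname{diag}(1,1,1,-1)$, $\mathrm{CPHASE}_\alpha = \operatorname{diag}(1,1,1,e^{i\alpha})$ and $i\mathrm{SWAP}$ (which fixes $|00\rangle, |11\rangle$ and sends $|01\rangle \mapsto i|10\rangle$, $|10\rangle \mapsto i|01\rangle$) be regarded as elements of it. For a set $\mathcal S \subseteq PU(4)$ let $P^n_{\mathcal S}$ be the set of all products $(A_n \otimes B_n) S_n (A_{n-1} \otimes B_{n-1}) \cdots S_1 (A_0 \otimes B_0)$ with $S_j \in \mathcal S$ and $A_j, B_j \in PU(2)$. Write $\mathrm{CPHASE} = \{\mathrm{CPHASE}_\alpha : 0 \le \alpha \le 2\pi\}$ for the gate set with free parameter. Let $\mathfrak A_{C_2}$ be the set of real quadruples $\delta = (\delta_1, \dots, \delta_4)$ with $\delta_1 \ge \delta_2 \ge \delta_3 \ge \delta_4 \ge \delta_1 - 1$, $\sum_j \delta_j = 0$, and either $\delta_3 + \frac12 > \delta_1$, or $\delta_3 + \frac12 = \delta_1$ and $\delta_4 + \frac12 \le \delta_2$. Let $Q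 = \frac{1}{\sqrt 2}\left(\begin{smallmatrix} 1 & 0 & 0 & i \\ 0 & i & 1 & 0 \\ 0 & i & -1 & 0 \\ 1 & 0 & 0 & -i \end{smallmatrix}\right)$ and, for $V \in SU(4)$, $V^Q = Q^\dagger V Q$. For $U \in PU(4)$ let $\Pi(U)$ be the unique $\delta \in \mathfrak A_{C_2}$ such that $e^{2\pi i \delta_1}, \dots, e^{2\pi i \delta_4}$ are the eigenvalues, with multiplicity, of $V^Q (V^Q)^T$ for some lift $V \in SU(4)$ of $U$. Then $$\Pi(P^2_{\mathrm{CPHASE}}) = \Pi(P^2_{\mathrm{CZ}}) = \Pi(P^2_{i\mathrm{SWAP}}) = \{\delta \in \mathfrak A_{C_2} : \delta_1 = -\delta_4,\ \delta_2 = -\delta_3\},$$ and this set is the triangle with vertices $(0,0,0,0)$, $(\frac14,\frac14,-\frac14,-\frac14)$, $(\frac12,0,0,-\frac12)$. Moreover $P^2_{\mathrm{CPHASE}} = P^2_{\mathrm{CZ}}$ and $P^3_{\mathrm{CPHASE}} = P^3_{\mathrm{CZ}}$. Consequently $P^2_{\mathrm{CPHASE}}$ has Haar measure zero in $PU(4)$,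 and $\Pi(P^2_{\mathrm{CPHASE}})$ has zero three-dimensional Euclidean volume in $\mathfrak A_{C_2}$. Let $\mathcal L_{\mathrm{CPHASE}}(U) \in \{0, 1, 2, \dots\} \cup \{\infty\}$ be the least $n$ with $U \in P^n_{\mathrm{CPHASE}}$. Then the expected circuit depth $\langle \mathcal L_{\mathrm{CPHASE}} \rangle$ equals $3$, both as $\int_{PU(4)} \mathcal L_{\mathrm{CPHASE}}(U)\, d\mu(U)$ for the normalized Haar measure $\mu$, and as $\int_{\mathfrak A_{C_2}} \mathcal L_{\mathrm{CPHASE}}(\Pi^{-1}(x))\, dx$ for the three-dimensional Euclidean volume on $\mathfrak A_{C_2}$ normalized to total mass one, where $\mathcal L_{\mathrm{CPHASE}}(\Pi^{-1}(x))$ is the (constant) value of $\mathcal L_{\mathrm{CPHASE}}$ on the fibre of $\Pi$ over $x$. -/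

import Mathlib

open scoped Matrix Kronecker Real ENNReal
open MeasureTheory

namespace TwoQubit
noncomputable section

/-! ### The projective unitary group `PU(4)` and its Haar measure -/

/-- The unitary group `U(4)`. Basis order: `|00⟩, |01⟩, |10⟩, |11⟩`. -/
abbrev U4 : Type := Matrix.unitaryGroup (Fin 4) ℂ

/-- The global phases: the scalar matrices in `U(4)`. -/
def phases : Subgroup U4 where
  carrier := {U | ∃ c : ℂ, (U : Matrix (Fin 4) (Fin 4) ℂ) = c • 1}
  one_mem' := ⟨1, by simp⟩
  mul_mem' := by
    rintro U V ⟨c, hc⟩ ⟨d, hd⟩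
    exact ⟨c * d, by simp [hc, hd, smul_smul, mul_comm]⟩
  inv_mem' := by
    rintro U ⟨c, hc⟩
    exact ⟨star c, by simp [hc]⟩

instance phases_normal : phases.Normal where
  conj_mem := by
    rintro U ⟨c, hc⟩ V
    refine ⟨c, ?_⟩
    have hV : (V : Matrix (Fin 4) (Fin 4) ℂ) * star (V : Matrix (Fin 4) (Fin 4) ℂ) = 1 :=
      Matrix.mem_unitaryGroup_iff.1 V.2
    simp [hc, hV]

/-- The group `PU(4)` of two-qubit programs, with the quotient topology. -/
abbrev PU4 : Type := U4 ⧸ phases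

instance compactSpace_U4 : CompactSpace U4 := by
  refine isCompact_iff_compactSpace.1 (IsCompact.of_isClosed_subset
    (s := Set.pi Set.univ fun _ : Fin 4 => Set.pi Set.univ fun _ : Fin 4 =>
      Metric.closedBall (0 : ℂ) 1)
    (isCompact_univ_pi fun _ => isCompact_univ_pi fun _ => isCompact_closedBall _ _)
    (isClosed_unitary (R := Matrix (Fin 4) (Fin 4) ℂ)) ?_)
  intro U hU i _ j _
  simpa using entry_norm_bound_of_unitary hU i j

instance measurableSpace_PU4 : MeasurableSpace PU4 := borel PU4

instance borelSpace_PU4 : BorelSpace PU4 := ⟨rfl⟩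

/-- The Haar measure of `PU(4)`, normalized to have total mass one. -/
def haarPU4 : Measure PU4 := Measure.haarMeasure ⊤

/-! ### Gates and circuits -/

/-- The operator `A ⊗ B` of a pair of one-qubit operators. -/
def tensor (A B : Matrix.unitaryGroup (Fin 2) ℂ) : U4 :=
  ⟨Matrix.reindex finProdFinEquiv finProdFinEquiv
      ((A : Matrix (Fin 2) (Fin 2) ℂ) ⊗ₖ (B : Matrix (Fin 2) (Fin 2) ℂ)), by
    have h := Matrix.mem_unitaryGroup_iff.1 (Matrix.kronecker_mem_unitary A.2 B.2)
    rw [Matrix.mem_unitaryGroup_iff, Matrix.star_eq_conjTranspose, Matrix.reindex_apply,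
      Matrix.conjTranspose_submatrix, Matrix.submatrix_mul_equiv, ← Matrix.star_eq_conjTranspose, h,
      Matrix.submatrix_one_equiv]⟩

/-- The local gates, i.e. the classes `A ⊗ B` with `A`, `B` one-qubit gates. -/
def localGates : Set PU4 := {g | ∃ A B : Matrix.unitaryGroup (Fin 2) ℂ, g = (tensor A B : U4)}

/-- `programs S n` is the set `P^n_S` of programs
`(A_n ⊗ B_n) S_n ⋯ (A_1 ⊗ B_1) S_1 (A_0 ⊗ B_0)` with all `S_j ∈ S`. -/
def programs (S : Set PU4) : ℕ → Set PU4
  | 0 => localGates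
  | n + 1 => {g | ∃ l ∈ localGates, ∃ s ∈ S, ∃ p ∈ programs S n, g = l * s * p}

/-- `CPHASE_α = diag(1, 1, 1, e^{iα})`. -/
def cphase (α : ℝ) : U4 :=
  ⟨Matrix.diagonal ![1, 1, 1, Complex.exp (α * Complex.I)], by
    rw [Matrix.mem_unitaryGroup_iff, Matrix.star_eq_conjTranspose, Matrix.diagonal_conjTranspose,
      Matrix.diagonal_mul_diagonal, ← Matrix.diagonal_one]
    congr 1
    funext j
    fin_cases j <;> simp [← Complex.exp_conj, ← Complex.exp_add]⟩

/-- `CZ = diag(1, 1, 1, -1)`. -/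
def cz : U4 :=
  ⟨!![1, 0, 0, 0; 0, 1, 0, 0; 0, 0, 1, 0; 0, 0, 0, -1], by
    rw [Matrix.mem_unitaryGroup_iff, Matrix.star_eq_conjTranspose]
    ext i j
    fin_cases i <;> fin_cases j <;> simp [Matrix.mul_apply, Fin.sum_univ_four]⟩

/-- The `iSWAP` gate. -/
def iswap : U4 :=
  ⟨!![1, 0, 0, 0; 0, 0, Complex.I, 0; 0, Complex.I, 0, 0; 0, 0, 0, 1], by
    rw [Matrix.mem_unitaryGroup_iff, Matrix.star_eq_conjTranspose]
    ext i j
    fin_cases i <;> fin_cases j <;> simp [Matrix.mul_apply, Fin.sum_univ_four]⟩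

/-- The gate set `CPHASE` with free parameter. -/
def cphaseGates : Set PU4 := {g | ∃ α : ℝ, 0 ≤ α ∧ α ≤ 2 * π ∧ g = (cphase α : U4)}

def czGates : Set PU4 := {((cz : U4) : PU4)}

def iswapGates : Set PU4 := {((iswap : U4) : PU4)}

/-! ### Logarithmic spectra and the map `Π` -/

/-- The fundamental alcove of `SU(4)`: `a₁ ≥ a₂ ≥ a₃ ≥ a₄ ≥ a₁ - 1` and `∑ aⱼ = 0`. -/
def alcove : Set (EuclideanSpace ℝ (Fin 4)) :=
  {a | Antitone (fun j => a j) ∧ a 0 - 1 ≤ a 3 ∧ ∑ j, a j = 0}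

/-- The fundamental alcove of `SU(4) / {±1}`. The coordinates `a 0, a 1, a 2, a 3` are the usual
`a₁, a₂, a₃, a₄`. -/
def alcoveC2 : Set (EuclideanSpace ℝ (Fin 4)) :=
  {a | a ∈ alcove ∧ (a 0 < a 2 + 1 / 2 ∨ (a 2 + 1 / 2 = a 0 ∧ a 3 + 1 / 2 ≤ a 1))}

/-- The spectrum of `M`, with multiplicity, is `e^{2πi a₁}, …, e^{2πi a₄}`. -/
def HasLogSpec (M : Matrix (Fin 4) (Fin 4) ℂ) (a : EuclideanSpace ℝ (Fin 4)) : Prop :=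
  M.charpoly.roots = Finset.univ.val.map fun j => Complex.exp (2 * π * Complex.I * (a j : ℂ))

/-- The change of basis `Q` to the magic basis. -/
def magicQ : Matrix (Fin 4) (Fin 4) ℂ :=
  ((1 / √2 : ℝ) : ℂ) • !![1, 0, 0, Complex.I; 0, Complex.I, 1, 0; 0, Complex.I, -1, 0;
    1, 0, 0, -Complex.I]

/-- The Cartan double `γ(V^Q) = V^Q (V^Q)ᵀ` with `V^Q = Q† V Q`. -/
def cartanDouble (V : Matrix (Fin 4) (Fin 4) ℂ) : Matrix (Fin 4) (Fin 4) ℂ :=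
  (magicQᴴ * V * magicQ) * (magicQᴴ * V * magicQ)ᵀ

/-- `a` is the point of `alcoveC2` that presents the spectrum of the Cartan double of one of the
lifts `V ∈ SU(4)` of `u`. Changing the lift changes the Cartan double by a sign at most. -/
def IsMonodromy (u : PU4) (a : EuclideanSpace ℝ (Fin 4)) : Prop :=
  a ∈ alcoveC2 ∧ ∃ V : U4, (V : Matrix (Fin 4) (Fin 4) ℂ).det = 1 ∧ (V : PU4) = u ∧
    HasLogSpec (cartanDouble V) a

theorem exists_mem_alcove (z : Fin 4 → ℂ) (hz : ∀ j, ‖z j‖ = 1) (hp : ∏ j, z j = 1) :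
    ∃ a ∈ alcove, (Finset.univ.val.map fun j => Complex.exp (2 * π * Complex.I * (a j : ℂ))) =
      Finset.univ.val.map z := by
  have h1 : ∀ j, ∃ t : ℝ, 0 ≤ t ∧ t < 1 ∧ Complex.exp (2 * π * Complex.I * (t : ℂ)) = z j := by
    intro j
    refine ⟨Int.fract ((z j).arg / (2 * π)), Int.fract_nonneg _, Int.fract_lt_one _, ?_⟩
    have h := Complex.norm_mul_exp_arg_mul_I (z j)
    rw [hz j] at h
    rw [Complex.ofReal_one, one_mul] at h
    refine Eq.trans ?_ h
    rw [Complex.exp_eq_exp_iff_exists_int]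
    refine ⟨-⌊(z j).arg / (2 * π)⌋, ?_⟩
    rw [Int.fract]
    have := Real.pi_ne_zero
    push_cast
    field_simp
    ring
  choose t h0 h1' hexp using h1
  set σ := Tuple.sort (fun j => - t j) with hσ
  have hm : Monotone ((fun j => - t j) ∘ σ) := Tuple.monotone_sort _
  set s : Fin 4 → ℝ := t ∘ σ with hs
  have hs0 : ∀ j, 0 ≤ s j := fun j => h0 _
  have hs1 : ∀ j, s j < 1 := fun j => h1' _
  have h01 : s 1 ≤ s 0 := neg_le_neg_iff.1 (hm (show (0 : Fin 4) ≤ 1 by decide))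
  have h12 : s 2 ≤ s 1 := neg_le_neg_iff.1 (hm (show (1 : Fin 4) ≤ 2 by decide))
  have h23 : s 3 ≤ s 2 := neg_le_neg_iff.1 (hm (show (2 : Fin 4) ≤ 3 by decide))
  have hmap : (Finset.univ.val.map fun j => Complex.exp (2 * π * Complex.I * (s j : ℂ))) =
      Finset.univ.val.map z := by
    have : (fun j => Complex.exp (2 * π * Complex.I * (s j : ℂ))) = z ∘ σ := by
      funext j; exact hexp _
    rw [this, ← Multiset.map_map]
    congr 1
    simp
  have hprod : Complex.exp (2 * π * Complex.I * ((∑ j, s j : ℝ) : ℂ)) = 1 := by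
    push_cast
    rw [Finset.mul_sum, Complex.exp_sum, ← hp]
    have := congrArg Multiset.prod hmap
    exact this
  obtain ⟨k, hk⟩ : ∃ k : ℤ, ∑ j, s j = k := by
    obtain ⟨n, hn⟩ := Complex.exp_eq_one_iff.1 hprod
    refine ⟨n, ?_⟩
    have : (2 * π * Complex.I : ℂ) ≠ 0 := Complex.two_pi_I_ne_zero
    rw [mul_comm] at hn
    exact_mod_cast mul_right_cancel₀ this hn
  rw [Fin.sum_univ_four] at hk
  have hk0 : (-1 : ℝ) < k := by
    rw [← hk]; linarith [hs0 0, hs0 1, hs0 2, hs0 3]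
  have hk4 : (k : ℝ) < 4 := by
    rw [← hk]; linarith [hs1 0, hs1 1, hs1 2, hs1 3]
  have hk0' : -1 < k := by exact_mod_cast hk0
  have hk4' : k < 4 := by exact_mod_cast hk4
  have e1 : ∀ x : ℝ, Complex.exp (2 * π * Complex.I * ((x - 1 : ℝ) : ℂ)) =
      Complex.exp (2 * π * Complex.I * (x : ℂ)) := by
    intro x
    push_cast
    rw [mul_sub, mul_one, Complex.exp_sub, Complex.exp_two_pi_mul_I, div_one]
  have huniv : ∀ f : Fin 4 → ℂ, Finset.univ.val.map f = {f 0, f 1, f 2, f 3} := by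
    intro f; rfl
  have anti : ∀ a : Fin 4 → ℝ, a 1 ≤ a 0 → a 2 ≤ a 1 → a 3 ≤ a 2 → Antitone a := by
    intro a h1 h2 h3
    refine Fin.antitone_iff_succ_le.2 ?_
    intro i
    fin_cases i <;> assumption
  have b0 := hs0 3
  have b1 := hs1 0
  rw [← hmap]
  simp only [huniv]
  interval_cases k
  · refine ⟨!₂[s 0, s 1, s 2, s 3], ⟨anti _ ?_ ?_ ?_, ?_, ?_⟩, ?_⟩ <;>
      simp [Fin.sum_univ_four] at hk ⊢ <;> linarith
  · refine ⟨!₂[s 1, s 2, s 3, s 0 - 1], ⟨anti _ ?_ ?_ ?_, ?_, ?_⟩, ?_⟩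
    iterate 5 (simp [Fin.sum_univ_four] at hk ⊢; linarith)
    simp [-Complex.ofReal_sub, e1]
    simp only [← Multiset.singleton_add]
    abel
  · refine ⟨!₂[s 2, s 3, s 0 - 1, s 1 - 1], ⟨anti _ ?_ ?_ ?_, ?_, ?_⟩, ?_⟩
    iterate 5 (simp [Fin.sum_univ_four] at hk ⊢; linarith)
    simp [-Complex.ofReal_sub, e1]
    simp only [← Multiset.singleton_add]
    abel
  · refine ⟨!₂[s 3, s 0 - 1, s 1 - 1, s 2 - 1], ⟨anti _ ?_ ?_ ?_, ?_, ?_⟩, ?_⟩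
    iterate 5 (simp [Fin.sum_univ_four] at hk ⊢; linarith)
    simp [-Complex.ofReal_sub, e1]
    simp only [← Multiset.singleton_add]
    abel


theorem alcove_unique {a b : EuclideanSpace ℝ (Fin 4)} (ha : a ∈ alcove) (hb : b ∈ alcove)
    (h : (Finset.univ.val.map fun j => Complex.exp (2 * π * Complex.I * (a j : ℂ))) =
      Finset.univ.val.map fun j => Complex.exp (2 * π * Complex.I * (b j : ℂ))) : a = b := by
  have key : ∀ t x : ℝ, Int.fract (t - (Complex.exp (2 * π * Complex.I * (x : ℂ))).arg / (2 * π)) =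
      Int.fract (t - x) := by
    intro t x
    set w := Complex.exp (2 * π * Complex.I * (x : ℂ)) with hw
    have hn : ‖w‖ = 1 := by
      rw [hw, show 2 * π * Complex.I * (x : ℂ) = ((2 * π * x : ℝ) : ℂ) * Complex.I by
        push_cast; ring]
      exact Complex.norm_exp_ofReal_mul_I _
    have h := Complex.norm_mul_exp_arg_mul_I w
    rw [hn, Complex.ofReal_one, one_mul] at h
    obtain ⟨n, hn⟩ := Complex.exp_eq_exp_iff_exists_int.1 (h.trans hw)
    have h2 : w.arg = 2 * π * x + n * (2 * π) := by
      have h3 : (w.arg : ℂ) * Complex.I = ((2 * π * x + n * (2 * π) : ℝ) : ℂ) * Complex.I := by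
        rw [hn]; push_cast; ring
      exact_mod_cast mul_right_cancel₀ Complex.I_ne_zero h3
    rw [h2, show t - (2 * π * x + n * (2 * π)) / (2 * π) = t - x - n by
      field_simp; ring, Int.fract_sub_intCast]
  have hF : ∀ t : ℝ, ∑ j, ⌊t - a j⌋ = ∑ j, ⌊t - b j⌋ := by
    intro t
    have h1 := congrArg (fun s : Multiset ℂ =>
      (s.map fun w => Int.fract (t - w.arg / (2 * π))).sum) h
    simp only [Multiset.map_map, Function.comp_def, key] at h1
    have h1' : ∑ j, Int.fract (t - a j) = ∑ j, Int.fract (t - b j) := h1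
    have h2 : ((∑ j, ⌊t - a j⌋ : ℤ) : ℝ) = ((∑ j, ⌊t - b j⌋ : ℤ) : ℝ) := by
      simp only [Int.fract, Finset.sum_sub_distrib, ha.2.2, hb.2.2] at h1'
      push_cast
      linarith
    exact_mod_cast h2
  have up : ∀ c ∈ alcove, ∀ i : Fin 4, -(i : ℤ) ≤ ∑ j, ⌊c i - c j⌋ := by
    intro c hc i
    have c01 : c 1 ≤ c 0 := hc.1 (show (0 : Fin 4) ≤ 1 by decide)
    have c12 : c 2 ≤ c 1 := hc.1 (show (1 : Fin 4) ≤ 2 by decide)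
    have c23 : c 3 ≤ c 2 := hc.1 (show (2 : Fin 4) ≤ 3 by decide)
    have c30 := hc.2.1
    have fl : ∀ j, (if i ≤ j then 0 else -1 : ℤ) ≤ ⌊c i - c j⌋ := by
      intro j
      rw [Int.le_floor]
      split_ifs with hij
      · simpa using hc.1 hij
      · push_cast
        have h0 : c j ≤ c 0 := hc.1 (Fin.zero_le j)
        have h3 : c 3 ≤ c i := hc.1 (Fin.le_last i)
        linarith
    refine le_trans ?_ (Finset.sum_le_sum fun j _ => fl j)
    rw [Fin.sum_univ_four]
    fin_cases i <;> decide
  have dn : ∀ c ∈ alcove, ∀ (i : Fin 4) (t : ℝ), t < c i → ∑ j, ⌊t - c j⌋ < -(i : ℤ) := by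
    intro c hc i t ht
    have c30 := hc.2.1
    have fl : ∀ j, ⌊t - c j⌋ ≤ (if j ≤ i then -1 else 0 : ℤ) := by
      intro j
      rw [← Int.lt_add_one_iff, Int.floor_lt]
      split_ifs with hij
      · have : c i ≤ c j := hc.1 hij
        push_cast
        linarith
      · push_cast
        have h0 : c i ≤ c 0 := hc.1 (Fin.zero_le i)
        have h3 : c 3 ≤ c j := hc.1 (Fin.le_last j)
        linarith
    refine lt_of_le_of_lt (Finset.sum_le_sum fun j _ => fl j) ?_
    rw [Fin.sum_univ_four]
    fin_cases i <;> decide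
  ext i
  rcases lt_trichotomy (a i) (b i) with hlt | heq | hlt
  · exact absurd (up a ha i) (by rw [hF]; exact not_le.2 (dn b hb i _ hlt))
  · exact heq
  · exact absurd (up b hb i) (by rw [← hF]; exact not_le.2 (dn a ha i _ hlt))

theorem magicQ_mul : magicQᴴ * magicQ = 1 := by
  have h2 : ((√2 : ℝ) : ℂ)⁻¹ * ((√2 : ℝ) : ℂ)⁻¹ = 1 / 2 := by
    rw [← mul_inv, ← Complex.ofReal_mul, Real.mul_self_sqrt (by norm_num)]
    norm_num
  ext i j
  fin_cases i <;> fin_cases j <;>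
    simp [magicQ, Matrix.mul_apply, Fin.sum_univ_four, mul_mul_mul_comm _ _ (_⁻¹), h2] <;> norm_num

theorem magicQ_mem : magicQ ∈ Matrix.unitaryGroup (Fin 4) ℂ :=
  Matrix.mem_unitaryGroup_iff'.2 magicQ_mul

theorem cartanDouble_mem (V : U4) : cartanDouble V ∈ Matrix.unitaryGroup (Fin 4) ℂ := by
  have h : magicQᴴ * (V : Matrix (Fin 4) (Fin 4) ℂ) * magicQ ∈ Matrix.unitaryGroup (Fin 4) ℂ :=
    mul_mem (mul_mem (Unitary.star_mem magicQ_mem) V.2) magicQ_mem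
  refine mul_mem h ?_
  exact Matrix.transpose_mem_unitaryGroup_iff.2 h

theorem det_cartanDouble (V : Matrix (Fin 4) (Fin 4) ℂ) : (cartanDouble V).det = V.det ^ 2 := by
  have h : magicQᴴ.det * magicQ.det = 1 := by rw [← Matrix.det_mul, magicQ_mul, Matrix.det_one]
  rw [cartanDouble, Matrix.det_mul, Matrix.det_transpose, Matrix.det_mul, Matrix.det_mul]
  linear_combination V.det ^ 2 * (magicQᴴ.det * magicQ.det + 1) * h

theorem cartanDouble_smul (c : ℂ) (V : Matrix (Fin 4) (Fin 4) ℂ) :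
    cartanDouble (c • V) = c ^ 2 • cartanDouble V := by
  simp [cartanDouble, smul_smul, sq]

theorem roots_charpoly_neg (M : Matrix (Fin 4) (Fin 4) ℂ) :
    (-M).charpoly.roots = M.charpoly.roots.map fun x => -x := by
  rw [← Polynomial.roots_comp_neg_X]
  congr 1
  have h : (M.charpoly.comp (-Polynomial.X)) =
      ((Polynomial.compRingHom (-Polynomial.X)).mapMatrix M.charmatrix).det := by
    rw [← RingHom.map_det]
    rfl
  rw [h, Matrix.charpoly, ← neg_neg ((Polynomial.compRingHom _).mapMatrix _), Matrix.det_neg]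
  simp only [Fintype.card_fin, (by decide : Even 4).neg_one_pow, one_mul]
  congr 1
  ext1 i j
  by_cases hij : i = j
  · subst hij
    simp [Matrix.charmatrix_apply_eq]
    ring
  · simp [Matrix.charmatrix_apply_ne _ _ _ hij]

theorem hasLogSpec_neg {M : Matrix (Fin 4) (Fin 4) ℂ} {b : EuclideanSpace ℝ (Fin 4)}
    (h : HasLogSpec M b) :
    HasLogSpec (-M) !₂[b 2 + 1 / 2, b 3 + 1 / 2, b 0 - 1 / 2, b 1 - 1 / 2] := by
  have huniv : ∀ f : Fin 4 → ℂ, Finset.univ.val.map f = {f 0, f 1, f 2, f 3} := by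
    intro f; rfl
  have hπ : Complex.exp (2 * π * Complex.I * (1 / 2)) = -1 := by
    rw [← Complex.exp_pi_mul_I]; congr 1; ring
  have e1 : ∀ x : ℝ, Complex.exp (2 * π * Complex.I * ((x - 1 / 2 : ℝ) : ℂ)) =
      -Complex.exp (2 * π * Complex.I * (x : ℂ)) := by
    intro x
    push_cast
    rw [mul_sub, Complex.exp_sub, hπ, div_neg, div_one]
  have e2 : ∀ x : ℝ, Complex.exp (2 * π * Complex.I * ((x + 1 / 2 : ℝ) : ℂ)) =
      -Complex.exp (2 * π * Complex.I * (x : ℂ)) := by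
    intro x
    push_cast
    rw [mul_add, Complex.exp_add, hπ, mul_neg, mul_one]
  unfold HasLogSpec at h ⊢
  rw [roots_charpoly_neg, h, Multiset.map_map, huniv, huniv]
  simp only [Function.comp_apply, Matrix.cons_val, e1, e2]
  simp only [Multiset.insert_eq_cons, ← Multiset.singleton_add]
  abel

theorem rotate_mem_alcove {b : EuclideanSpace ℝ (Fin 4)} (hb : b ∈ alcove) :
    !₂[b 2 + 1 / 2, b 3 + 1 / 2, b 0 - 1 / 2, b 1 - 1 / 2] ∈ alcove := by
  have c01 : b 1 ≤ b 0 := hb.1 (show (0 : Fin 4) ≤ 1 by decide)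
  have c12 : b 2 ≤ b 1 := hb.1 (show (1 : Fin 4) ≤ 2 by decide)
  have c23 : b 3 ≤ b 2 := hb.1 (show (2 : Fin 4) ≤ 3 by decide)
  have c30 := hb.2.1
  have hs := hb.2.2
  rw [Fin.sum_univ_four] at hs
  refine ⟨Fin.antitone_iff_succ_le.2 ?_, ?_, ?_⟩
  · intro i
    fin_cases i <;> simp <;> linarith
  · simp
    linarith
  · simp [Fin.sum_univ_four]
    linarith

open scoped ComplexOrder in
theorem exists_hasLogSpec (V : U4) (hV : (V : Matrix (Fin 4) (Fin 4) ℂ).det = 1) :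
    ∃ a ∈ alcove, HasLogSpec (cartanDouble V) a := by
  set M := cartanDouble V with hM
  have hcard : M.charpoly.roots.card = 4 := by
    rw [← (IsAlgClosed.splits M.charpoly).natDegree_eq_card_roots, Matrix.charpoly_natDegree_eq_dim,
      Fintype.card_fin]
  obtain ⟨l, hl⟩ := Quot.exists_rep M.charpoly.roots
  have hl' : (l : Multiset ℂ) = M.charpoly.roots := hl
  have hlen : l.length = 4 := by rw [← hcard, ← hl', Multiset.coe_card]
  set z : Fin 4 → ℂ := fun j => l.get (Fin.cast hlen.symm j) with hz
  have hroots : Finset.univ.val.map z = M.charpoly.roots := by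
    rw [← hl', Fin.univ_val_map]
    congr 1
    refine List.ext_get (by simp [hlen]) ?_
    intro n h1 h2
    simp only [List.get_eq_getElem, List.getElem_ofFn, hz, Fin.val_cast]
  have hnorm : ∀ j, ‖z j‖ = 1 := by
    intro j
    have hj : z j ∈ M.charpoly.roots := by
      rw [← hroots]
      exact Multiset.mem_map_of_mem z (Finset.mem_univ_val j)
    have hroot := (Polynomial.mem_roots (Matrix.charpoly_monic M).ne_zero).1 hj
    obtain ⟨v, hv0, hv⟩ := Matrix.exists_mulVec_eq_zero_iff.2
      (show (Matrix.scalar (Fin 4) (z j) - M).det = 0 by rw [← Matrix.eval_charpoly]; exact hroot)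
    have hv' : M *ᵥ v = z j • v := by
      rw [Matrix.sub_mulVec, sub_eq_zero] at hv
      rw [← hv]
      ext i
      simp [Matrix.mulVec_diagonal]
    have hu : Mᴴ * M = 1 := Matrix.mem_unitaryGroup_iff'.1 (cartanDouble_mem V)
    have hnv : star v ⬝ᵥ v ≠ 0 := by
      intro h0
      exact hv0 (dotProduct_star_self_eq_zero.1 h0)
    have h1 : star (M *ᵥ v) ⬝ᵥ (M *ᵥ v) = star v ⬝ᵥ v := by
      rw [Matrix.star_mulVec, ← Matrix.dotProduct_mulVec, Matrix.mulVec_mulVec, hu,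
        Matrix.one_mulVec]
    rw [hv', star_smul, smul_dotProduct, dotProduct_smul, smul_smul] at h1
    have h2 : star (z j) * z j = 1 := by
      have : (star (z j) * z j - 1) * (star v ⬝ᵥ v) = 0 := by
        rw [sub_mul, one_mul, sub_eq_zero]
        exact h1
      exact sub_eq_zero.1 ((mul_eq_zero.1 this).resolve_right hnv)
    have h3 : ((‖z j‖ ^ 2 : ℝ) : ℂ) = 1 := by
      rw [← h2]
      push_cast
      exact (Complex.conj_mul' (z j)).symm
    have h4 : ‖z j‖ ^ 2 = 1 := by exact_mod_cast h3
    exact (pow_eq_one_iff_of_nonneg (norm_nonneg _) two_ne_zero).1 h4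
  have hprod : ∏ j, z j = 1 := by
    have h1 : M.det = 1 := by rw [hM, det_cartanDouble, hV, one_pow]
    rw [Matrix.det_eq_prod_roots_charpoly, ← hroots] at h1
    exact h1
  obtain ⟨a, ha, h⟩ := exists_mem_alcove z hnorm hprod
  exact ⟨a, ha, by rw [HasLogSpec, ← hroots, h]⟩

/-- A scalar multiple of a unitary by a number of modulus one. -/
theorem smul_mem_U4 {c : ℂ} (hc : star c * c = 1) (U : U4) :
    c • (U : Matrix (Fin 4) (Fin 4) ℂ) ∈ Matrix.unitaryGroup (Fin 4) ℂ := by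
  have hU := Matrix.mem_unitaryGroup_iff.1 U.2
  rw [Matrix.mem_unitaryGroup_iff, star_smul, Matrix.smul_mul, Matrix.mul_smul, hU, smul_smul,
    mul_comm, hc, one_smul]

theorem mk_smul {c : ℂ} (hc : star c * c = 1) (U : U4) :
    ((⟨c • (U : Matrix (Fin 4) (Fin 4) ℂ), smul_mem_U4 hc U⟩ : U4) : PU4) = (U : PU4) := by
  refine (QuotientGroup.eq.2 ?_).symm
  refine (show ∃ d : ℂ, _ = d • (1 : Matrix (Fin 4) (Fin 4) ℂ) from ⟨c, ?_⟩)
  have hU := Matrix.mem_unitaryGroup_iff'.1 U.2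
  simp [hU]

theorem exists_isMonodromy (u : PU4) : ∃ a, IsMonodromy u a := by
  obtain ⟨U, rfl⟩ := QuotientGroup.mk_surjective u
  obtain ⟨c, hc, hdet⟩ : ∃ c : ℂ, star c * c = 1 ∧
      (c • (U : Matrix (Fin 4) (Fin 4) ℂ)).det = 1 := by
    obtain ⟨c, hc⟩ := IsAlgClosed.exists_pow_nat_eq
      ((star (U : Matrix (Fin 4) (Fin 4) ℂ)).det) (n := 4) (by norm_num)
    have hU := congrArg Matrix.det (Matrix.mem_unitaryGroup_iff'.1 U.2)
    rw [Matrix.det_mul, Matrix.det_one] at hU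
    refine ⟨c, ?_, by rw [Matrix.det_smul, Fintype.card_fin, hc, hU]⟩
    have h1 : (star c * c) ^ 4 = 1 := by
      rw [mul_pow, ← star_pow, hc, ← hU, Matrix.star_eq_conjTranspose, Matrix.det_conjTranspose,
        star_star, mul_comm]
    have h2 : star c * c = ((‖c‖ ^ 2 : ℝ) : ℂ) := by
      push_cast
      exact Complex.conj_mul' c
    rw [h2] at h1 ⊢
    have h3 : (‖c‖ ^ 2) ^ 4 = 1 := by exact_mod_cast h1
    rw [(pow_eq_one_iff_of_nonneg (by positivity) (by norm_num)).1 h3, Complex.ofReal_one]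
  set V : U4 := ⟨_, smul_mem_U4 hc U⟩ with hVdef
  have hV : (V : PU4) = U := mk_smul hc U
  obtain ⟨b, hb, hlog⟩ := exists_hasLogSpec V hdet
  by_cases hb2 : b ∈ alcoveC2
  · exact ⟨b, hb2, V, hdet, hV, hlog⟩
  · have hI : star Complex.I * Complex.I = 1 := by simp
    refine ⟨_, ⟨rotate_mem_alcove hb, ?_⟩, ⟨_, smul_mem_U4 hI V⟩, ?_, (mk_smul hI V).trans hV, ?_⟩
    · have hb3 : ¬ (b 0 < b 2 + 1 / 2 ∨ (b 2 + 1 / 2 = b 0 ∧ b 3 + 1 / 2 ≤ b 1)) :=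
        fun h => hb2 ⟨hb, h⟩
      push Not at hb3
      obtain ⟨h1, h2⟩ := hb3
      rcases h1.lt_or_eq with h | h
      · left
        simp
        linarith
      · right
        have := h2 h
        simp
        constructor <;> linarith
    · have h4 : Complex.I ^ 4 = 1 := Complex.I_pow_four
      rw [Matrix.det_smul, Fintype.card_fin, h4, one_mul]
      exact hdet
    · have := hasLogSpec_neg hlog
      rw [show cartanDouble (Complex.I • (V : Matrix (Fin 4) (Fin 4) ℂ)) = -cartanDouble V by
        rw [cartanDouble_smul, Complex.I_sq, neg_smul, one_smul]]
      exact this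

theorem isMonodromy_unique {u : PU4} {a b : EuclideanSpace ℝ (Fin 4)} (ha : IsMonodromy u a)
    (hb : IsMonodromy u b) : a = b := by
  obtain ⟨ha2, V, hV, hVu, hVa⟩ := ha
  obtain ⟨hb2, W, hW, hWu, hWb⟩ := hb
  obtain ⟨c, hc⟩ : V⁻¹ * W ∈ phases := QuotientGroup.eq.1 (hVu.trans hWu.symm)
  have hWV : (W : Matrix (Fin 4) (Fin 4) ℂ) = c • (V : Matrix (Fin 4) (Fin 4) ℂ) := by
    have h1 : W = V * (V⁻¹ * W) := by group
    rw [h1, Submonoid.coe_mul, hc, Matrix.mul_smul, Matrix.mul_one]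
  have hc4 : c ^ 4 = 1 := by
    rw [hWV, Matrix.det_smul, hV, Fintype.card_fin, mul_one] at hW
    exact hW
  have hc2 : c ^ 2 = 1 ∨ c ^ 2 = -1 := by
    have h : (c ^ 2 - 1) * (c ^ 2 + 1) = 0 := by linear_combination hc4
    rcases mul_eq_zero.1 h with h | h
    · exact Or.inl (sub_eq_zero.1 h)
    · exact Or.inr (eq_neg_of_add_eq_zero_left h)
  rw [hWV, cartanDouble_smul] at hWb
  rcases hc2 with h | h
  · rw [h, one_smul] at hWb
    exact alcove_unique ha2.1 hb2.1 (hVa.symm.trans hWb)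
  · rw [h, neg_smul, one_smul] at hWb
    have hab := alcove_unique hb2.1 (rotate_mem_alcove ha2.1) (hWb.symm.trans (hasLogSpec_neg hVa))
    have h0 : b 0 = a 2 + 1 / 2 := by rw [hab]; rfl
    have h1 : b 1 = a 3 + 1 / 2 := by rw [hab]; rfl
    have h2 : b 2 = a 0 - 1 / 2 := by rw [hab]; rfl
    have h3 : b 3 = a 1 - 1 / 2 := by rw [hab]; rfl
    have ha3 := ha2.2
    have hb3 := hb2.2
    rw [h0, h1, h2, h3] at hb3
    have e0 : a 0 = a 2 + 1 / 2 := by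
      rcases ha3 with h | h <;> rcases hb3 with h' | h' <;> linarith
    have e1 : a 1 = a 3 + 1 / 2 := by
      rcases ha3 with h | h <;> rcases hb3 with h' | h' <;> linarith
    ext i
    fin_cases i
    · exact e0.trans h0.symm
    · exact e1.trans h1.symm
    · exact (by linarith : a 2 = a 0 - 1 / 2).trans h2.symm
    · exact (by linarith : a 3 = a 1 - 1 / 2).trans h3.symm

/-- The map `Π : PU(4) → 𝔄_{C₂}`, `Π(u) = LogSpec γ(u^Q)`: the point `a` with `IsMonodromy u a`,
which exists and is unique. -/
def monodromy (u : PU4) : EuclideanSpace ℝ (Fin 4) := (exists_isMonodromy u).choose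

/-- The triangle `δ₁ = -δ₄`, `δ₂ = -δ₃` in `alcoveC2`. -/
def triangle : Set (EuclideanSpace ℝ (Fin 4)) := {d | d ∈ alcoveC2 ∧ d 0 = -d 3 ∧ d 1 = -d 2}

/-! ### Depth -/

/-- The minimal number of gates from `S` in a circuit for `u` (`⊤` if there is no circuit). -/
def depth (S : Set PU4) (u : PU4) : ℕ∞ := ⨅ (n : ℕ) (_ : u ∈ programs S n), (n : ℕ∞)

/-- The expected circuit depth with respect to the Haar measure. -/
def expectedDepthHaar (S : Set PU4) : ℝ≥0∞ := ∫⁻ u, (depth S u : ℝ≥0∞) ∂haarPU4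

/-- The three-dimensional Euclidean volume on `alcoveC2`, normalized to total mass one. -/
def alcoveVolume : Measure (EuclideanSpace ℝ (Fin 4)) :=
  (μH[3] alcoveC2)⁻¹ • (μH[3] : Measure (EuclideanSpace ℝ (Fin 4))).restrict alcoveC2

/-- The expected circuit depth with respect to the volume of the alcove: the integral over
`x` in `alcoveC2` of the (constant) value of the depth on the fibre of `Π` over `x`. -/
def expectedDepthAlcove (S : Set PU4) : ℝ≥0∞ :=
  ∫⁻ x, ((⨅ (u : PU4) (_ : monodromy u = x), depth S u : ℕ∞) : ℝ≥0∞) ∂alcoveVolume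

end
end TwoQubit

/-!
Conjugation by `Q` turns the form `X ↦ X J Xᵀ`, with `J = Q Qᵀ = -Y ⊗ Y`, into `X ↦ X Xᵀ`, and a
local operator `T = A ⊗ B` satisfies `T J Tᵀ = det A · det B · J` (`tensor_spinFlip`). So local
gates with determinant one become real rotations in the magic basis, they conjugate the Cartan
double `γ(V)`, and `tr γ(V)` is a local invariant up to a scalar.

**Real trace and the triangle.** For `V ∈ SU(4)` with logarithmic spectrum `a` the imaginary part
of `tr γ(V)` is `4 sin π(a₁ + a₂) sin π(a₂ + a₃) sin π(a₁ + a₃)`, and for `a` in `alcoveC2` this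
vanishes exactly on the triangle (`mem_triangle_iff_trace_real`). An explicit formula for the
trace of `CPHASE_α (A ⊗ B) CPHASE_β` shows that it is real for every lift of a program with two
`CPHASE` gates (`trace_real_of_mem_programs`).

**The converse.** Every rotation of the magic basis is local, because `SO(4)` is generated by
Givens rotations of adjacent rows and these have explicit local preimages
(`mem_magicLocal_of_orthogonal`). Diagonalizing the symmetric unitary matrix `γ(V)` by a rotation
then yields the Cartan decomposition: `V` is, up to local gates on both sides, diagonal in the
magic basis, with half the logarithmic spectrum as eigenphases (`exists_cartan_decomposition`).
For a point of the triangle the diagonal operator is the circuit of `magicDiagonal_eq_circuit`,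
with two `CZ` gates. Hence `P²_CPHASE = P²_CZ`, and this set consists of the classes of those
`V ∈ SU(4)` for which `tr γ(V)` is real. Since `iSWAP` is `CZ` times a swap up to local gates,
`P²_iSWAP` is the same set.

**Three gates.** For every operator `D` that is diagonal in the magic basis, the trace of
`γ(CZ (1 ⊗ H) D)` is zero (`trace_cartanDouble_cz_hadamard`). So `CZ (1 ⊗ H) D` needs two `CZ`
gates only, and `P³_CZ` is all of `PU(4)`.

**Null sets.** Along the curve `t ↦ h_t u`, where `h_t` is diagonal in the magic basis with
eigenphases `3t, -t, -t, -t`, the imaginary part of the trace is up to a nonzero factor a cubic polynomial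
in `e^{4it}`, with the first entry of `γ(u)` as leading coefficient. If this entry is nonzero the
curve meets `P²` at countably many times only, and by Fubini these `u` contribute measure zero;
finitely many local translates of the set of all such `u` cover `PU(4)` by compactness
(`haarPU4_programs_two`). In the alcove, the triangle is contained in a Lipschitz image of the
plane, whereas the alcove has positive finite three-dimensional measure. So in both senses the
depth is `3` almost everywhere.
-/

namespace TwoQubit
noncomputable section

/-! ### Tensor products and the spin-flip form -/

theorem tensor_eq (A B : Matrix.unitaryGroup (Fin 2) ℂ) :
    (tensor A B : Matrix (Fin 4) (Fin 4) ℂ) =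
      !![A 0 0 * B 0 0, A 0 0 * B 0 1, A 0 1 * B 0 0, A 0 1 * B 0 1;
        A 0 0 * B 1 0, A 0 0 * B 1 1, A 0 1 * B 1 0, A 0 1 * B 1 1;
        A 1 0 * B 0 0, A 1 0 * B 0 1, A 1 1 * B 0 0, A 1 1 * B 0 1;
        A 1 0 * B 1 0, A 1 0 * B 1 1, A 1 1 * B 1 0, A 1 1 * B 1 1] := by
  ext i j
  fin_cases i <;> fin_cases j <;> rfl

theorem tensor_mul (A B C D : Matrix.unitaryGroup (Fin 2) ℂ) :
    tensor A B * tensor C D = tensor (A * C) (B * D) := by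
  apply Subtype.ext
  simp only [tensor, Submonoid.coe_mul, Matrix.reindex_apply, Matrix.submatrix_mul_equiv,
    Matrix.mul_kronecker_mul]

theorem tensor_one : tensor 1 1 = 1 := by
  apply Subtype.ext
  simp [tensor]

/-- The symmetric matrix `Q Qᵀ`, which is `-Y ⊗ Y` for the Pauli matrix `Y`. -/
def spinFlip : Matrix (Fin 4) (Fin 4) ℂ :=
  !![0, 0, 0, 1; 0, 0, -1, 0; 0, -1, 0, 0; 1, 0, 0, 0]

theorem inv_sqrt_two_mul_self : ((√2 : ℝ) : ℂ)⁻¹ * ((√2 : ℝ) : ℂ)⁻¹ = 1 / 2 := by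
  rw [← mul_inv, ← Complex.ofReal_mul, Real.mul_self_sqrt (by norm_num)]
  norm_num

theorem magicQ_mul_transpose : magicQ * magicQᵀ = spinFlip := by
  ext i j
  fin_cases i <;> fin_cases j <;>
    simp [magicQ, spinFlip, Matrix.mul_apply, Fin.sum_univ_four,
      mul_mul_mul_comm _ _ (_⁻¹), inv_sqrt_two_mul_self] <;> norm_num

/-- Local operators preserve the form of `spinFlip` up to a factor, because `A Y Aᵀ = det A · Y`
for every two by two matrix `A`. -/
theorem tensor_spinFlip (A B : Matrix.unitaryGroup (Fin 2) ℂ) :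
    (tensor A B : Matrix (Fin 4) (Fin 4) ℂ) * spinFlip * (tensor A B : Matrix (Fin 4) (Fin 4) ℂ)ᵀ =
      ((A : Matrix (Fin 2) (Fin 2) ℂ).det * (B : Matrix (Fin 2) (Fin 2) ℂ).det) • spinFlip := by
  rw [tensor_eq, Matrix.det_fin_two, Matrix.det_fin_two]
  ext i j
  fin_cases i <;> fin_cases j <;>
    simp [spinFlip, Matrix.mul_apply, Fin.sum_univ_four] <;> ring

/-! ### The trace of the Cartan double -/

/-- The trace of the Cartan double in the computational basis. -/
theorem trace_cartanDouble (U : Matrix (Fin 4) (Fin 4) ℂ) :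
    (cartanDouble U).trace = (U * spinFlip * Uᵀ * spinFlip).trace := by
  have h1 : (magicQᴴᵀ * magicQᴴ : Matrix (Fin 4) (Fin 4) ℂ) = spinFlip := by
    have h2 := congrArg (fun M : Matrix (Fin 4) (Fin 4) ℂ => Mᴴ) magicQ_mul_transpose
    simp only [Matrix.conjTranspose_mul] at h2
    rw [show magicQᴴᵀ = magicQᵀᴴ from rfl, h2]
    ext i j
    fin_cases i <;> fin_cases j <;> simp [spinFlip]
  rw [cartanDouble]
  nth_rewrite 2 [← h1]
  rw [← magicQ_mul_transpose]
  simp only [Matrix.transpose_mul, Matrix.mul_assoc]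
  rw [Matrix.trace_mul_comm]
  simp only [Matrix.mul_assoc]

/-- The factor by which the trace of the Cartan double scales under `A ⊗ B`. -/
def localDet (A B : Matrix.unitaryGroup (Fin 2) ℂ) : ℂ :=
  (A : Matrix (Fin 2) (Fin 2) ℂ).det * (B : Matrix (Fin 2) (Fin 2) ℂ).det

theorem det_tensor (A B : Matrix.unitaryGroup (Fin 2) ℂ) :
    (tensor A B : Matrix (Fin 4) (Fin 4) ℂ).det = localDet A B ^ 2 := by
  rw [tensor, localDet, Matrix.det_reindex_self, Matrix.det_kronecker]
  simp [mul_pow]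

theorem localDet_ne_zero (A B : Matrix.unitaryGroup (Fin 2) ℂ) : localDet A B ≠ 0 := by
  intro h
  have h1 := congrArg Matrix.det (Matrix.mem_unitaryGroup_iff.1 (tensor A B).2)
  rw [Matrix.det_mul, det_tensor, h] at h1
  simp at h1

theorem tensor_transpose_spinFlip (A B : Matrix.unitaryGroup (Fin 2) ℂ) :
    (tensor A B : Matrix (Fin 4) (Fin 4) ℂ)ᵀ * spinFlip * (tensor A B : Matrix (Fin 4) (Fin 4) ℂ) =
      localDet A B • spinFlip := by
  rw [localDet, Matrix.det_fin_two, Matrix.det_fin_two, tensor_eq]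
  ext i j
  fin_cases i <;> fin_cases j <;>
    simp [spinFlip, Matrix.mul_apply, Fin.sum_univ_four] <;> ring

theorem trace_cartanDouble_tensor_mul (A B C D : Matrix.unitaryGroup (Fin 2) ℂ)
    (U : Matrix (Fin 4) (Fin 4) ℂ) :
    (cartanDouble (tensor A B * U * tensor C D)).trace =
      localDet A B * localDet C D * (cartanDouble U).trace := by
  simp only [trace_cartanDouble, Matrix.transpose_mul]
  set T : Matrix (Fin 4) (Fin 4) ℂ := (tensor A B).1
  set S : Matrix (Fin 4) (Fin 4) ℂ := (tensor C D).1
  have hT : Tᵀ * spinFlip * T = _ := tensor_transpose_spinFlip A B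
  have hS : S * spinFlip * Sᵀ = _ := tensor_spinFlip C D
  calc (T * U * S * spinFlip * (Sᵀ * (Uᵀ * Tᵀ)) * spinFlip).trace
      = (T * (U * (S * spinFlip * Sᵀ) * Uᵀ * Tᵀ * spinFlip)).trace := by
        simp only [Matrix.mul_assoc]
    _ = (U * (S * spinFlip * Sᵀ) * Uᵀ * (Tᵀ * spinFlip * T)).trace := by
        rw [Matrix.trace_mul_comm]; simp only [Matrix.mul_assoc]
    _ = _ := by
        rw [hT, hS]
        simp [localDet, Matrix.mul_assoc]
        ring

/-- The permanent of a two by two unitary matrix is a real multiple of its determinant, because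
the second row is a multiple of `(-b̄, ā)` if the first is `(a, b)`. -/
theorem perm_fin_two_of_unitary (A : Matrix.unitaryGroup (Fin 2) ℂ) :
    ∃ r : ℝ, A 0 0 * A 1 1 + A 0 1 * A 1 0 = r * (A : Matrix (Fin 2) (Fin 2) ℂ).det := by
  have h := Matrix.mem_unitaryGroup_iff.1 A.2
  have h' := Matrix.mem_unitaryGroup_iff'.1 A.2
  have e1 := congrFun (congrFun h 0) 0
  have e2 := congrFun (congrFun h 0) 1
  have e4 := congrFun (congrFun h 1) 1
  have f1 := congrFun (congrFun h' 0) 0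
  simp [Matrix.mul_apply, Matrix.star_apply] at e1 e2 e4 f1
  refine ⟨‖A 0 0‖ ^ 2 - ‖A 0 1‖ ^ 2, ?_⟩
  rw [Matrix.det_fin_two]
  push_cast
  rw [← Complex.mul_conj', ← Complex.mul_conj']
  generalize A 0 0 = a at *
  generalize A 0 1 = b at *
  generalize A 1 0 = c at *
  generalize A 1 1 = d at *
  have e3 := congrArg (starRingEnd ℂ) e2
  simp at e3
  set a' := (starRingEnd ℂ) a
  set b' := (starRingEnd ℂ) b
  set c' := (starRingEnd ℂ) c
  set d' := (starRingEnd ℂ) d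
  linear_combination (-(a * d) - b * c) * e1 + 2 * a * b * e3

theorem trace_cartanDouble_cphase (α β : ℝ) (A B : Matrix.unitaryGroup (Fin 2) ℂ) :
    (cartanDouble ((cphase α * tensor A B * cphase β : U4) : Matrix (Fin 4) (Fin 4) ℂ)).trace =
      (1 + Complex.exp (α * Complex.I)) * (1 + Complex.exp (β * Complex.I)) * localDet A B +
        (Complex.exp (α * Complex.I) - 1) * (Complex.exp (β * Complex.I) - 1) *
          ((A 0 0 * A 1 1 + A 0 1 * A 1 0) * (B 0 0 * B 1 1 + B 0 1 * B 1 0)) := by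
  rw [trace_cartanDouble, localDet, Matrix.det_fin_two, Matrix.det_fin_two]
  simp only [Submonoid.coe_mul, tensor_eq, cphase]
  generalize Complex.exp (α * Complex.I) = p
  generalize Complex.exp (β * Complex.I) = q
  rw [show Matrix.diagonal ![1, 1, 1, p] = !![1, 0, 0, 0; 0, 1, 0, 0; 0, 0, 1, 0; 0, 0, 0, p] by
    ext i j; fin_cases i <;> fin_cases j <;> rfl,
    show Matrix.diagonal ![1, 1, 1, q] = !![1, 0, 0, 0; 0, 1, 0, 0; 0, 0, 1, 0; 0, 0, 0, q] by
    ext i j; fin_cases i <;> fin_cases j <;> rfl]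
  simp only [Matrix.trace, Matrix.diag, Matrix.mul_apply, Fin.sum_univ_four, spinFlip]
  simp
  ring

theorem exp_eq_half_sq (α : ℝ) : ∃ e : ℂ, Complex.exp (α * Complex.I) = e ^ 2 ∧
    star e * e = 1 := by
  refine ⟨Complex.exp ((α / 2 : ℝ) * Complex.I), ?_, ?_⟩
  · rw [← Complex.exp_nat_mul]
    congr 1
    push_cast
    ring
  · rw [Complex.star_def, Complex.conj_mul', Complex.norm_exp_ofReal_mul_I]
    simp

/-- The trace of the Cartan double of `CPHASE_α (A ⊗ B) CPHASE_β` is real up to a square root of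
the determinant. -/
theorem exists_trace_cartanDouble_cphase (α β : ℝ) (A B : Matrix.unitaryGroup (Fin 2) ℂ) :
    ∃ e : ℂ, e ^ 2 = Complex.exp (α * Complex.I) * Complex.exp (β * Complex.I) ∧ ∃ r : ℝ,
    (cartanDouble ((cphase α * tensor A B * cphase β : U4) : Matrix (Fin 4) (Fin 4) ℂ)).trace =
      e * localDet A B * r := by
  obtain ⟨a, ha, ha1⟩ := exp_eq_half_sq α
  obtain ⟨b, hb, hb1⟩ := exp_eq_half_sq β
  obtain ⟨r, hr⟩ := perm_fin_two_of_unitary A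
  obtain ⟨s, hs⟩ := perm_fin_two_of_unitary B
  refine ⟨a * b, by rw [ha, hb]; ring, 4 * a.re * b.re - 4 * a.im * b.im * (r * s), ?_⟩
  rw [trace_cartanDouble_cphase, ha, hb, hr, hs, localDet]
  have key : ∀ z : ℂ, star z * z = 1 → 1 + z ^ 2 = 2 * z * z.re ∧
      z ^ 2 - 1 = 2 * Complex.I * z * z.im := by
    intro z hz
    have h1 : z.re * z.re + z.im * z.im = 1 := by
      have := congrArg Complex.re hz
      simp at this
      exact this
    constructor <;> apply Complex.ext <;> simp [sq] <;> nlinarith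
  obtain ⟨a1, a2⟩ := key a ha1
  obtain ⟨b1, b2⟩ := key b hb1
  rw [a1, a2, b1, b2]
  push_cast
  linear_combination (4 * (a * a.im * b * b.im) * r * s * (A : Matrix (Fin 2) (Fin 2) ℂ).det *
    (B : Matrix (Fin 2) (Fin 2) ℂ).det) * Complex.I_sq

theorem eq_smul_of_mk_eq {U V : U4} (h : (U : PU4) = V) : ∃ c : ℂ,
    (V : Matrix (Fin 4) (Fin 4) ℂ) = c • (U : Matrix (Fin 4) (Fin 4) ℂ) := by
  obtain ⟨c, hc⟩ : U⁻¹ * V ∈ phases := QuotientGroup.eq.1 h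
  refine ⟨c, ?_⟩
  have h1 : V = U * (U⁻¹ * V) := by group
  rw [h1, Submonoid.coe_mul, hc, Matrix.mul_smul, Matrix.mul_one]

/-- The lift contributes a factor whose square is the determinant of the lift, so the remaining
phase of the trace is a sign. -/
theorem trace_real_of_mem_programs {V : U4} (hV : (V : Matrix (Fin 4) (Fin 4) ℂ).det = 1)
    (h : (V : PU4) ∈ programs cphaseGates 2) :
    (cartanDouble (V : Matrix (Fin 4) (Fin 4) ℂ)).trace.im = 0 := by
  obtain ⟨_, ⟨A₂, B₂, rfl⟩, _, ⟨α, -, -, rfl⟩, _, ⟨_, ⟨A₁, B₁, rfl⟩, _, ⟨β, -, -, rfl⟩, _,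
    ⟨A₀, B₀, rfl⟩, rfl⟩, hu⟩ := h
  obtain ⟨z, hz⟩ := eq_smul_of_mk_eq (U := tensor A₂ B₂ * (cphase α * tensor A₁ B₁ * cphase β) *
    tensor A₀ B₀) (V := V) (by rw [hu]; simp [mul_assoc])
  obtain ⟨e, he, r, hr⟩ := exists_trace_cartanDouble_cphase α β A₁ B₁
  have hdet : ∀ γ : ℝ, (cphase γ : Matrix (Fin 4) (Fin 4) ℂ).det = Complex.exp (γ * Complex.I) := by
    intro γ
    simp [cphase, Matrix.det_diagonal, Fin.prod_univ_four]
  rw [hz, cartanDouble_smul, Matrix.trace_smul, Submonoid.coe_mul, Submonoid.coe_mul,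
    trace_cartanDouble_tensor_mul, hr]
  rw [hz, Matrix.det_smul] at hV
  simp only [Submonoid.coe_mul, Matrix.det_mul, det_tensor, hdet, Fintype.card_fin] at hV
  set w := z ^ 2 * (localDet A₂ B₂ * localDet A₁ B₁ * localDet A₀ B₀) * e with hw
  have hw2 : w ^ 2 = 1 := by
    rw [← hV, hw]
    linear_combination (z ^ 4 * (localDet A₂ B₂ * localDet A₁ B₁ * localDet A₀ B₀) ^ 2) * he
  have : z ^ 2 • (localDet A₂ B₂ * localDet A₀ B₀ * (e * localDet A₁ B₁ * r)) = w * r := by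
    rw [hw, smul_eq_mul]; ring
  rw [this]
  rcases sq_eq_one_iff.1 hw2 with h | h <;> simp [h]

/-! ### The triangle in the alcove -/

theorem sin_add_sin_add_sin_sub_sin (x y z : ℝ) :
    Real.sin (2 * x) + Real.sin (2 * y) + Real.sin (2 * z) - Real.sin (2 * (x + y + z)) =
      4 * Real.sin (x + y) * Real.sin (y + z) * Real.sin (x + z) := by
  have h1 : Real.sin (2 * x) + Real.sin (2 * y) = 2 * Real.sin (x + y) * Real.cos (x - y) := by
    rw [Real.sin_add_sin]; ring_nf
  have h2 : Real.sin (2 * z) - Real.sin (2 * (x + y + z)) =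
      -2 * Real.sin (x + y) * Real.cos (x + y + 2 * z) := by
    rw [Real.sin_sub_sin, show (2 * z - 2 * (x + y + z)) / 2 = -(x + y) by ring, Real.sin_neg]
    ring_nf
  have h3 : Real.cos (x - y) - Real.cos (x + y + 2 * z) =
      2 * Real.sin (x + z) * Real.sin (y + z) := by
    rw [Real.cos_sub_cos, show (x - y - (x + y + 2 * z)) / 2 = -(y + z) by ring, Real.sin_neg]
    ring_nf
  linear_combination h1 + h2 + 2 * Real.sin (x + y) * h3

theorem alcove_le {a : EuclideanSpace ℝ (Fin 4)} (ha : a ∈ alcove) :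
    a 1 ≤ a 0 ∧ a 2 ≤ a 1 ∧ a 3 ≤ a 2 ∧ a 0 - 1 ≤ a 3 ∧ a 0 + a 1 + a 2 + a 3 = 0 := by
  refine ⟨ha.1 (show (0 : Fin 4) ≤ 1 by decide), ha.1 (show (1 : Fin 4) ≤ 2 by decide),
    ha.1 (show (2 : Fin 4) ≤ 3 by decide), ha.2.1, ?_⟩
  rw [← Fin.sum_univ_four, ha.2.2]

theorem mem_alcove_iff {a : EuclideanSpace ℝ (Fin 4)} : a ∈ alcove ↔
    a 1 ≤ a 0 ∧ a 2 ≤ a 1 ∧ a 3 ≤ a 2 ∧ a 0 - 1 ≤ a 3 ∧ a 0 + a 1 + a 2 + a 3 = 0 := by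
  refine ⟨alcove_le, fun ⟨h1, h2, h3, h4, h5⟩ => ⟨Fin.antitone_iff_succ_le.2 fun i => ?_, h4, ?_⟩⟩
  · fin_cases i <;> assumption
  · rw [Fin.sum_univ_four, h5]

theorem mem_triangle_iff {a : EuclideanSpace ℝ (Fin 4)} : a ∈ triangle ↔
    a 1 ≤ a 0 ∧ 0 ≤ a 1 ∧ a 0 + a 1 ≤ 1 / 2 ∧ a 2 = -a 1 ∧ a 3 = -a 0 := by
  simp only [triangle, alcoveC2, Set.mem_ofPred_eq, mem_alcove_iff]
  constructor
  · rintro ⟨⟨⟨h1, h2, h3, h4, h5⟩, h6⟩, h7, h8⟩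
    refine ⟨h1, ?_, ?_, ?_, ?_⟩ <;> rcases h6 with h6 | h6 <;> linarith
  · rintro ⟨h1, h2, h3, h4, h5⟩
    rw [h4, h5]
    refine ⟨⟨⟨h1, ?_, ?_, ?_, ?_⟩, ?_⟩, ?_, ?_⟩ <;> try linarith
    rcases h3.lt_or_eq with h | h
    · left; linarith
    · right; constructor <;> linarith

theorem trace_of_hasLogSpec {M : Matrix (Fin 4) (Fin 4) ℂ} {a : EuclideanSpace ℝ (Fin 4)}
    (h : HasLogSpec M a) : M.trace = ∑ j, Complex.exp ((2 * π * a j : ℝ) * Complex.I) := by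
  rw [Matrix.trace_eq_sum_roots_charpoly, h]
  change ∑ j, _ = _
  congr 1
  funext j
  congr 1
  push_cast
  ring

theorem trace_im_of_hasLogSpec {M : Matrix (Fin 4) (Fin 4) ℂ} {a : EuclideanSpace ℝ (Fin 4)}
    (ha : a ∈ alcove) (h : HasLogSpec M a) : M.trace.im =
      4 * Real.sin (π * (a 0 + a 1)) * Real.sin (π * (a 1 + a 2)) * Real.sin (π * (a 0 + a 2)) := by
  obtain ⟨-, -, -, -, h0⟩ := alcove_le ha
  rw [trace_of_hasLogSpec h, Complex.im_sum, Fin.sum_univ_four]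
  simp only [Complex.exp_ofReal_mul_I_im]
  rw [show 2 * π * a 3 = -(2 * (π * a 0 + π * a 1 + π * a 2)) by
    rw [show a 3 = -(a 0 + a 1 + a 2) by linarith]; ring, Real.sin_neg]
  have := sin_add_sin_add_sin_sub_sin (π * a 0) (π * a 1) (π * a 2)
  simp only [mul_add, mul_assoc] at this ⊢
  linarith

/-- By `trace_im_of_hasLogSpec` the trace is real iff one of three pair sums of the coordinates is
an integer; the inequalities of the alcove allow only the value `0`, which forces
`a 1 + a 2 = 0`. -/
theorem mem_triangle_iff_trace_real {M : Matrix (Fin 4) (Fin 4) ℂ} {a : EuclideanSpace ℝ (Fin 4)}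
    (ha : a ∈ alcoveC2) (h : HasLogSpec M a) : a ∈ triangle ↔ M.trace.im = 0 := by
  rw [trace_im_of_hasLogSpec ha.1 h]
  have hsin : ∀ t : ℝ, -1 < t → t < 1 → Real.sin (π * t) = 0 → t = 0 := by
    intro t h1 h2 ht
    obtain ⟨n, hn⟩ := Real.sin_eq_zero_iff.1 ht
    have hn : (n : ℝ) = t := by
      rw [mul_comm] at hn
      exact mul_left_cancel₀ Real.pi_ne_zero hn
    rw [← hn] at h1 h2 ⊢
    have h1' : -1 < n := by exact_mod_cast h1
    have h2' : n < 1 := by exact_mod_cast h2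
    have : n = 0 := by omega
    simp [this]
  obtain ⟨h1, h2, h3, h4, h5⟩ := alcove_le ha.1
  have h6 : a 0 ≤ a 2 + 1 / 2 := by rcases ha.2 with h | h <;> linarith
  constructor
  · intro ht
    have : a 1 + a 2 = 0 := by linarith [ht.2.2]
    simp [this]
  · intro h0
    have : a 1 + a 2 = 0 := by
      rcases mul_eq_zero.1 h0 with h0 | h0
      · rcases mul_eq_zero.1 h0 with h0 | h0
        · have := hsin _ (by linarith) (by linarith) ((mul_eq_zero.1 h0).resolve_left (by norm_num))
          linarith
        · exact hsin _ (by linarith) (by linarith) h0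
      · have := hsin _ (by linarith) (by linarith) h0
        linarith
    exact ⟨ha, by linarith, by linarith⟩

theorem triangle_eq_convexHull : triangle = convexHull ℝ
    {!₂[0, 0, 0, 0], !₂[1 / 4, 1 / 4, -1 / 4, -1 / 4], !₂[1 / 2, 0, 0, -1 / 2]} := by
  apply Set.Subset.antisymm
  · intro a ha
    rw [mem_triangle_iff] at ha
    obtain ⟨h1, h2, h3, h4, h5⟩ := ha
    set v : Fin 3 → EuclideanSpace ℝ (Fin 4) :=
      ![!₂[0, 0, 0, 0], !₂[1 / 4, 1 / 4, -1 / 4, -1 / 4], !₂[1 / 2, 0, 0, -1 / 2]] with hv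
    -- barycentric coordinates
    set w : Fin 3 → ℝ := ![1 - 2 * (a 0 + a 1), 4 * a 1, 2 * (a 0 - a 1)] with hw
    have hmem := (convex_convexHull ℝ {!₂[(0 : ℝ), 0, 0, 0], !₂[1 / 4, 1 / 4, -1 / 4, -1 / 4],
      !₂[1 / 2, 0, 0, -1 / 2]}).sum_mem (t := Finset.univ) (w := w) (z := v)
      (by intro i _; fin_cases i <;> simp [hw] <;> linarith)
      (by simp [hw, Fin.sum_univ_three]; ring)
      (by intro i _; apply subset_convexHull; fin_cases i <;> simp [hv])
    convert hmem using 1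
    ext i
    fin_cases i <;> simp [hw, hv, Fin.sum_univ_three, h4, h5] <;> ring
  · refine convexHull_min ?_ ?_
    · rintro a (rfl | rfl | rfl) <;> rw [mem_triangle_iff] <;> simp <;> norm_num
    · intro a ha b hb s t hs ht hst
      rw [mem_triangle_iff] at ha hb ⊢
      obtain ⟨a1, a2, a3, a4, a5⟩ := ha
      obtain ⟨b1, b2, b3, b4, b5⟩ := hb
      simp only [PiLp.add_apply, PiLp.smul_apply, smul_eq_mul, a4, a5, b4, b5]
      refine ⟨?_, ?_, ?_, ?_, ?_⟩
      · nlinarith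
      · nlinarith
      · nlinarith
      · ring
      · ring

/-! ### Local operators in the magic basis -/

/-- The matrices, in the magic basis, of the tensor products of one-qubit operators. -/
def magicLocal : Set (Matrix (Fin 4) (Fin 4) ℂ) :=
  {M | ∃ A B : Matrix.unitaryGroup (Fin 2) ℂ, magicQᴴ * (tensor A B).1 * magicQ = M}

theorem magicQ_mul' : magicQ * magicQᴴ = 1 := mul_eq_one_comm.1 magicQ_mul

/-- A convenient criterion: the action on the columns of `√2 Q` avoids the square roots. -/
theorem mem_magicLocal {A B : Matrix.unitaryGroup (Fin 2) ℂ} {M : Matrix (Fin 4) (Fin 4) ℂ}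
    (h : (tensor A B).1 * !![1, 0, 0, Complex.I; 0, Complex.I, 1, 0; 0, Complex.I, -1, 0;
      1, 0, 0, -Complex.I] = !![1, 0, 0, Complex.I; 0, Complex.I, 1, 0; 0, Complex.I, -1, 0;
      1, 0, 0, -Complex.I] * M) : M ∈ magicLocal := by
  refine ⟨A, B, ?_⟩
  have h' : (tensor A B).1 * magicQ = magicQ * M := by
    rw [magicQ, Matrix.mul_smul, h, Matrix.smul_mul]
  rw [Matrix.mul_assoc, h', ← Matrix.mul_assoc, magicQ_mul, Matrix.one_mul]

theorem mul_mem_magicLocal {M N : Matrix (Fin 4) (Fin 4) ℂ} (hM : M ∈ magicLocal)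
    (hN : N ∈ magicLocal) : M * N ∈ magicLocal := by
  obtain ⟨A, B, rfl⟩ := hM
  obtain ⟨C, D, rfl⟩ := hN
  refine ⟨A * C, B * D, ?_⟩
  rw [← tensor_mul, Submonoid.coe_mul]
  calc _ = magicQᴴ * (tensor A B).1 * 1 * (tensor C D).1 * magicQ := by
        simp [Matrix.mul_assoc]
    _ = _ := by
        rw [← magicQ_mul']
        simp only [Matrix.mul_assoc]

theorem one_mem_magicLocal : 1 ∈ magicLocal := ⟨1, 1, by simp [tensor_one, magicQ_mul]⟩

/-- The rotation `exp(iφX)` with `u = cos φ` and `v = sin φ`. -/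
def xRot (u v : ℝ) (h : u ^ 2 + v ^ 2 = 1) : Matrix.unitaryGroup (Fin 2) ℂ :=
  ⟨!![u, v * Complex.I; v * Complex.I, u], by
    have h' : (u : ℂ) ^ 2 + (v : ℂ) ^ 2 = 1 := by exact_mod_cast h
    rw [Matrix.mem_unitaryGroup_iff]
    ext i j
    fin_cases i <;> fin_cases j <;> simp [Matrix.mul_apply, Matrix.star_apply] <;>
      first
      | linear_combination h' - (v : ℂ) ^ 2 * Complex.I_sq
      | ring⟩

/-- The rotation `exp(iφZ)` with `u = cos φ` and `v = sin φ`. -/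
def zRot (u v : ℝ) (h : u ^ 2 + v ^ 2 = 1) : Matrix.unitaryGroup (Fin 2) ℂ :=
  ⟨!![u + v * Complex.I, 0; 0, u - v * Complex.I], by
    have h' : (u : ℂ) ^ 2 + (v : ℂ) ^ 2 = 1 := by exact_mod_cast h
    rw [Matrix.mem_unitaryGroup_iff]
    ext i j
    fin_cases i <;> fin_cases j <;> simp [Matrix.mul_apply, Matrix.star_apply] <;>
      linear_combination h' - (v : ℂ) ^ 2 * Complex.I_sq⟩

/-- Square roots on the unit circle. -/
theorem exists_half_angle {c s : ℝ} (h : c ^ 2 + s ^ 2 = 1) :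
    ∃ u v : ℝ, u ^ 2 + v ^ 2 = 1 ∧ c = u ^ 2 - v ^ 2 ∧ s = 2 * u * v := by
  obtain ⟨w, hw⟩ := IsAlgClosed.exists_pow_nat_eq (⟨c, s⟩ : ℂ) (n := 2) (by norm_num)
  have h1 := congrArg Complex.re hw
  have h2 := congrArg Complex.im hw
  simp [sq] at h1 h2
  refine ⟨w.re, w.im, ?_, by linarith, by linarith⟩
  have h3 : (w.re ^ 2 + w.im ^ 2) ^ 2 = 1 := by
    rw [← h, ← h1, ← h2]; ring
  exact (pow_eq_one_iff_of_nonneg (by positivity) two_ne_zero).1 h3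

theorem mul_fin_four {R : Type*} [CommRing R]
    (a00 a01 a02 a03 a10 a11 a12 a13 a20 a21 a22 a23 a30 a31 a32 a33 : R)
    (b00 b01 b02 b03 b10 b11 b12 b13 b20 b21 b22 b23 b30 b31 b32 b33 : R) :
    !![a00, a01, a02, a03;
    a10, a11, a12, a13;
    a20, a21, a22, a23;
    a30, a31, a32, a33] *
    !![b00, b01, b02, b03;
    b10, b11, b12, b13;
    b20, b21, b22, b23;
    b30, b31, b32, b33] =
    !![a00 * b00 + a01 * b10 + a02 * b20 + a03 * b30,
        a00 * b01 + a01 * b11 + a02 * b21 + a03 * b31,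
        a00 * b02 + a01 * b12 + a02 * b22 + a03 * b32,
        a00 * b03 + a01 * b13 + a02 * b23 + a03 * b33;
        a10 * b00 + a11 * b10 + a12 * b20 + a13 * b30,
        a10 * b01 + a11 * b11 + a12 * b21 + a13 * b31,
        a10 * b02 + a11 * b12 + a12 * b22 + a13 * b32,
        a10 * b03 + a11 * b13 + a12 * b23 + a13 * b33;
        a20 * b00 + a21 * b10 + a22 * b20 + a23 * b30,
        a20 * b01 + a21 * b11 + a22 * b21 + a23 * b31,
        a20 * b02 + a21 * b12 + a22 * b22 + a23 * b32,
        a20 * b03 + a21 * b13 + a22 * b23 + a23 * b33;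
        a30 * b00 + a31 * b10 + a32 * b20 + a33 * b30,
        a30 * b01 + a31 * b11 + a32 * b21 + a33 * b31,
        a30 * b02 + a31 * b12 + a32 * b22 + a33 * b32,
        a30 * b03 + a31 * b13 + a32 * b23 + a33 * b33] := by
  ext i j
  fin_cases i <;> fin_cases j <;> simp [Matrix.mul_apply, Fin.sum_univ_four]

theorem tensor_xRot (u v u' w : ℝ) (h : u ^ 2 + v ^ 2 = 1) (h' : u' ^ 2 + w ^ 2 = 1) :
    (tensor (xRot u v h) (xRot u' w h')).1 =
      !![(u * u' : ℂ), u * w * Complex.I, v * u' * Complex.I, -(v * w);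
        u * w * Complex.I, u * u', -(v * w), v * u' * Complex.I;
        v * u' * Complex.I, -(v * w), u * u', u * w * Complex.I;
        -(v * w), v * u' * Complex.I, u * w * Complex.I, u * u'] := by
  have hI := Complex.I_mul_I
  rw [tensor_eq]
  ext i j
  fin_cases i <;> fin_cases j <;> simp [xRot] <;>
    first | ring1 | linear_combination (v * w : ℂ) * hI

theorem tensor_zRot (u v : ℝ) (h : u ^ 2 + v ^ 2 = 1) (h' : u ^ 2 + (-v) ^ 2 = 1) :
    (tensor (zRot u v h) (zRot u (-v) h')).1 =
      !![(u * u + v * v : ℂ), 0, 0, 0;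
        0, u * u - v * v + 2 * u * v * Complex.I, 0, 0;
        0, 0, u * u - v * v - 2 * u * v * Complex.I, 0;
        0, 0, 0, (u * u + v * v : ℂ)] := by
  have hI := Complex.I_mul_I
  rw [tensor_eq]
  ext i j
  fin_cases i <;> fin_cases j <;> simp [zRot] <;>
    first
    | linear_combination (v * v : ℂ) * hI
    | linear_combination -(v * v : ℂ) * hI

theorem givens_zero_mem_magicLocal {c s : ℝ} (h : c ^ 2 + s ^ 2 = 1) :
    !![(c : ℂ), s, 0, 0; -s, c, 0, 0; 0, 0, 1, 0; 0, 0, 0, 1] ∈ magicLocal := by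
  obtain ⟨u, v, huv, rfl, rfl⟩ := exists_half_angle h
  have huv' : u ^ 2 + (-v) ^ 2 = 1 := by rw [neg_sq, huv]
  have h' : (u * u + v * v : ℂ) = 1 := by rw [← sq, ← sq]; exact_mod_cast huv
  have key :
      !![(u * u - v * v : ℂ), 2 * u * v, 0, 0;
        -(2 * u * v), (u * u - v * v), 0, 0;
        0, 0, (u * u + v * v), 0;
        0, 0, 0, (u * u + v * v)] ∈ magicLocal := by
    refine mem_magicLocal (A := xRot u (-v) huv') (B := xRot u (-v) huv') ?_
    have hI := Complex.I_mul_I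
    rw [tensor_xRot]
    simp only [mul_fin_four]
    ext i j
    fin_cases i <;> fin_cases j <;> simp <;>
      first
      | ring1
      | linear_combination (2 * u * v : ℂ) * hI
      | linear_combination (-2 * u * v : ℂ) * hI
  simp only [h'] at key
  convert key using 1
  push_cast
  simp [sq]

theorem givens_one_mem_magicLocal {c s : ℝ} (h : c ^ 2 + s ^ 2 = 1) :
    !![(1 : ℂ), 0, 0, 0; 0, c, s, 0; 0, -s, c, 0; 0, 0, 0, 1] ∈ magicLocal := by
  obtain ⟨u, v, huv, rfl, rfl⟩ := exists_half_angle h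
  have huv' : u ^ 2 + (-v) ^ 2 = 1 := by rw [neg_sq, huv]
  have h' : (u * u + v * v : ℂ) = 1 := by rw [← sq, ← sq]; exact_mod_cast huv
  have key :
      !![(u * u + v * v : ℂ), 0, 0, 0;
        0, (u * u - v * v), 2 * u * v, 0;
        0, -(2 * u * v), (u * u - v * v), 0;
        0, 0, 0, (u * u + v * v)] ∈ magicLocal := by
    refine mem_magicLocal (A := zRot u v huv) (B := zRot u (-v) huv') ?_
    have hI := Complex.I_mul_I
    rw [tensor_zRot]
    simp only [mul_fin_four]
    ext i j
    fin_cases i <;> fin_cases j <;> simp <;>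
      first
      | ring1
      | linear_combination (2 * u * v : ℂ) * hI
      | linear_combination (-2 * u * v : ℂ) * hI
  simp only [h'] at key
  convert key using 1
  push_cast
  simp [sq]

theorem givens_two_mem_magicLocal {c s : ℝ} (h : c ^ 2 + s ^ 2 = 1) :
    !![(1 : ℂ), 0, 0, 0; 0, 1, 0, 0; 0, 0, c, s; 0, 0, -s, c] ∈ magicLocal := by
  obtain ⟨u, v, huv, rfl, rfl⟩ := exists_half_angle h
  have huv' : u ^ 2 + (-v) ^ 2 = 1 := by rw [neg_sq, huv]
  have h' : (u * u + v * v : ℂ) = 1 := by rw [← sq, ← sq]; exact_mod_cast huv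
  have key :
      !![(u * u + v * v : ℂ), 0, 0, 0;
        0, (u * u + v * v), 0, 0;
        0, 0, (u * u - v * v), 2 * u * v;
        0, 0, -(2 * u * v), (u * u - v * v)] ∈ magicLocal := by
    refine mem_magicLocal (A := xRot u v huv) (B := xRot u (-v) huv') ?_
    have hI := Complex.I_mul_I
    rw [tensor_xRot]
    simp only [mul_fin_four]
    ext i j
    fin_cases i <;> fin_cases j <;> simp <;>
      first
      | ring1
      | linear_combination (2 * u * v : ℂ) * hI
      | linear_combination (-2 * u * v : ℂ) * hI
  simp only [h'] at key
  convert key using 1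
  push_cast
  simp [sq]

/-- The rotation of the plane that takes `(a, b)` to the nonnegative first half-axis. -/
theorem exists_givens (a b : ℝ) :
    ∃ c s : ℝ, c ^ 2 + s ^ 2 = 1 ∧ -s * a + c * b = 0 ∧ 0 ≤ c * a + s * b := by
  rcases eq_or_ne (a ^ 2 + b ^ 2) 0 with h | h
  · have ha : a = 0 := by nlinarith [sq_nonneg a, sq_nonneg b]
    have hb : b = 0 := by nlinarith [sq_nonneg a, sq_nonneg b]
    exact ⟨1, 0, by simp [ha, hb]⟩
  · have hr : 0 < a ^ 2 + b ^ 2 := lt_of_le_of_ne (by positivity) h.symm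
    have hr' : 0 < √(a ^ 2 + b ^ 2) := Real.sqrt_pos.2 hr
    have hs := Real.sq_sqrt hr.le
    refine ⟨a / √(a ^ 2 + b ^ 2), b / √(a ^ 2 + b ^ 2), ?_, by ring, ?_⟩
    · rw [div_pow, div_pow, hs]
      field_simp
    · rw [show a / √(a ^ 2 + b ^ 2) * a + b / √(a ^ 2 + b ^ 2) * b =
        (a ^ 2 + b ^ 2) / √(a ^ 2 + b ^ 2) by ring]
      positivity

/-- The Givens rotation of the adjacent rows `k` and `k + 1` by the angle with cosine `c` and
sine `s`. -/
def givens (k : Fin 3) (c s : ℝ) : Matrix (Fin 4) (Fin 4) ℝ :=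
  match k with
  | 0 => !![c, s, 0, 0; -s, c, 0, 0; 0, 0, 1, 0; 0, 0, 0, 1]
  | 1 => !![1, 0, 0, 0; 0, c, s, 0; 0, -s, c, 0; 0, 0, 0, 1]
  | 2 => !![1, 0, 0, 0; 0, 1, 0, 0; 0, 0, c, s; 0, 0, -s, c]

theorem givens_mem_magicLocal (k : Fin 3) {c s : ℝ} (h : c ^ 2 + s ^ 2 = 1) :
    (givens k c s).map Complex.ofReal ∈ magicLocal := by
  fin_cases k
  · convert givens_zero_mem_magicLocal h using 1
    ext i j
    fin_cases i <;> fin_cases j <;> simp [givens]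
  · convert givens_one_mem_magicLocal h using 1
    ext i j
    fin_cases i <;> fin_cases j <;> simp [givens]
  · convert givens_two_mem_magicLocal h using 1
    ext i j
    fin_cases i <;> fin_cases j <;> simp [givens]

theorem givens_transpose_mul (k : Fin 3) {c s : ℝ} (h : c ^ 2 + s ^ 2 = 1) :
    (givens k c s)ᵀ * givens k c s = 1 := by
  have h2 : c * c + s * s = 1 := by linarith
  have h3 : s * s + c * c = 1 := by linarith
  ext i j
  fin_cases k <;> fin_cases i <;> fin_cases j <;>
    simp [givens, Matrix.mul_apply, Fin.sum_univ_four, h2, h3] <;> ring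

theorem givens_transpose (k : Fin 3) (c s : ℝ) : (givens k c s)ᵀ = givens k c (-s) := by
  ext i j
  fin_cases k <;> fin_cases i <;> fin_cases j <;> simp [givens]

theorem det_givens (k : Fin 3) {c s : ℝ} (h : c ^ 2 + s ^ 2 = 1) : (givens k c s).det = 1 := by
  have h2 : c * c + s * s = 1 := by linarith
  fin_cases k <;> simp [givens, Matrix.det_succ_row_zero, Fin.sum_univ_succ, Fin.succAbove, h2]

theorem map_ofReal_mul (M N : Matrix (Fin 4) (Fin 4) ℝ) :
    (M * N).map Complex.ofReal = M.map Complex.ofReal * N.map Complex.ofReal :=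
  Matrix.map_mul (f := Complex.ofRealHom)

/-- A Givens rotation of rows `k` and `k + 1` clears the entry in row `k + 1` of column `j`. -/
theorem exists_givens_step (k : Fin 3) (j : Fin 4) {O : Matrix (Fin 4) (Fin 4) ℝ}
    (hO : Oᵀ * O = 1) (hdet : O.det = 1) :
    ∃ O' : Matrix (Fin 4) (Fin 4) ℝ, O'ᵀ * O' = 1 ∧ O'.det = 1 ∧
      (O'.map Complex.ofReal ∈ magicLocal → O.map Complex.ofReal ∈ magicLocal) ∧
      O' k.succ j = 0 ∧ 0 ≤ O' k.castSucc j ∧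
      (∀ i l, i ≠ k.castSucc → i ≠ k.succ → O' i l = O i l) ∧
      (∀ l, O k.castSucc l = 0 → O k.succ l = 0 → O' k.castSucc l = 0 ∧ O' k.succ l = 0) := by
  obtain ⟨c, s, h, h0, hpos⟩ := exists_givens (O k.castSucc j) (O k.succ j)
  have h' : c ^ 2 + (-s) ^ 2 = 1 := by rw [neg_sq, h]
  have e1 : ∀ l, (givens k c s * O) k.castSucc l = c * O k.castSucc l + s * O k.succ l := by
    intro l
    fin_cases k <;> simp [givens, Matrix.mul_apply, Fin.sum_univ_four]
  have e2 : ∀ l, (givens k c s * O) k.succ l = -s * O k.castSucc l + c * O k.succ l := by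
    intro l
    fin_cases k <;> simp [givens, Matrix.mul_apply, Fin.sum_univ_four]
  refine ⟨givens k c s * O, ?_, ?_, ?_, ?_, ?_, ?_, ?_⟩
  · rw [Matrix.transpose_mul, Matrix.mul_assoc, ← Matrix.mul_assoc (givens k c s)ᵀ,
      givens_transpose_mul k h, Matrix.one_mul, hO]
  · rw [Matrix.det_mul, det_givens k h, hdet, one_mul]
  · intro hm
    have h1 := mul_mem_magicLocal (givens_mem_magicLocal k h') hm
    rw [← map_ofReal_mul, ← givens_transpose, ← Matrix.mul_assoc,
      givens_transpose_mul k h, Matrix.one_mul] at h1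
    exact h1
  · rw [e2, h0]
  · rw [e1]; exact hpos
  · intro i l h1 h2
    fin_cases k <;> fin_cases i <;>
      simp [givens, Matrix.mul_apply, Fin.sum_univ_four] at h1 h2 ⊢
  · intro l h1 h2
    rw [e1, e2, h1, h2]
    simp

theorem eq_one_of_upperTriangular {O : Matrix (Fin 4) (Fin 4) ℝ} (hO : Oᵀ * O = 1)
    (hdet : O.det = 1) (h10 : O 1 0 = 0) (h20 : O 2 0 = 0) (h30 : O 3 0 = 0) (h21 : O 2 1 = 0)
    (h31 : O 3 1 = 0) (h32 : O 3 2 = 0) (p0 : 0 ≤ O 0 0) (p1 : 0 ≤ O 1 1) (p2 : 0 ≤ O 2 2) :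
    O = 1 := by
  have e : ∀ i j, ∑ k, O k i * O k j = (1 : Matrix (Fin 4) (Fin 4) ℝ) i j := by
    intro i j; rw [← hO]; rfl
  simp only [Fin.sum_univ_four] at e
  have sq1 : ∀ x : ℝ, 0 ≤ x → x * x = 1 → x = 1 := by intro x h1 h2; nlinarith
  have a00 : O 0 0 = 1 := sq1 _ p0 (by simpa [h10, h20, h30] using e 0 0)
  have a01 : O 0 1 = 0 := by simpa [h10, h20, h30, a00] using e 0 1
  have a02 : O 0 2 = 0 := by simpa [h10, h20, h30, a00] using e 0 2
  have a03 : O 0 3 = 0 := by simpa [h10, h20, h30, a00] using e 0 3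
  have a11 : O 1 1 = 1 := sq1 _ p1 (by simpa [h21, h31, a01] using e 1 1)
  have a12 : O 1 2 = 0 := by simpa [h21, h31, a01, a11] using e 1 2
  have a13 : O 1 3 = 0 := by simpa [h21, h31, a01, a11] using e 1 3
  have a22 : O 2 2 = 1 := sq1 _ p2 (by simpa [h32, a02, a12] using e 2 2)
  have a23 : O 2 3 = 0 := by simpa [h32, a02, a12, a22] using e 2 3
  have a33 : O 3 3 = 1 := by
    rw [Matrix.det_of_isUpperTriangular, Fin.prod_univ_four, a00, a11, a22] at hdet
    · simpa using hdet
    · intro i j hij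
      fin_cases i <;> fin_cases j <;> simp at hij <;> assumption
  ext i j
  fin_cases i <;> fin_cases j <;> simp [*]

/-- Every rotation of the magic basis is local: `SU(2) × SU(2)` covers `SO(4)`. -/
theorem mem_magicLocal_of_orthogonal {O : Matrix (Fin 4) (Fin 4) ℝ} (hO : Oᵀ * O = 1)
    (hdet : O.det = 1) : O.map Complex.ofReal ∈ magicLocal := by
  obtain ⟨A, hA, dA, mA, zA, -, -, -⟩ := exists_givens_step 2 0 hO hdet
  obtain ⟨B, hB, dB, mB, zB, -, kB, -⟩ := exists_givens_step 1 0 hA dA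
  obtain ⟨C, hC, dC, mC, zC, pC, kC, -⟩ := exists_givens_step 0 0 hB dB
  obtain ⟨D, hD, dD, mD, zD, -, kD, oD⟩ := exists_givens_step 2 1 hC dC
  obtain ⟨E, hE, dE, mE, zE, pE, kE, oE⟩ := exists_givens_step 1 1 hD dD
  obtain ⟨F, hF, dF, mF, zF, pF, kF, oF⟩ := exists_givens_step 2 2 hE dE
  refine mA (mB (mC (mD (mE (mF ?_)))))
  replace zA : A 3 0 = 0 := zA
  replace zB : B 2 0 = 0 := zB
  have B30 : B 3 0 = 0 := by rw [kB 3 0 (by decide) (by decide), zA]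
  replace zC : C 1 0 = 0 := zC
  have C20 : C 2 0 = 0 := by rw [kC 2 0 (by decide) (by decide), zB]
  have C30 : C 3 0 = 0 := by rw [kC 3 0 (by decide) (by decide), B30]
  replace pC : 0 ≤ C 0 0 := pC
  replace zD : D 3 1 = 0 := zD
  have D10 : D 1 0 = 0 := by rw [kD 1 0 (by decide) (by decide), zC]
  obtain ⟨D20, D30⟩ : D 2 0 = 0 ∧ D 3 0 = 0 := oD 0 C20 C30
  have D00 : 0 ≤ D 0 0 := by rw [kD 0 0 (by decide) (by decide)]; exact pC
  replace zE : E 2 1 = 0 := zE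
  replace pE : 0 ≤ E 1 1 := pE
  obtain ⟨E10, E20⟩ : E 1 0 = 0 ∧ E 2 0 = 0 := oE 0 D10 D20
  have E30 : E 3 0 = 0 := by rw [kE 3 0 (by decide) (by decide), D30]
  have E31 : E 3 1 = 0 := by rw [kE 3 1 (by decide) (by decide), zD]
  have E00 : 0 ≤ E 0 0 := by rw [kE 0 0 (by decide) (by decide)]; exact D00
  obtain ⟨F20, F30⟩ : F 2 0 = 0 ∧ F 3 0 = 0 := oF 0 E20 E30
  obtain ⟨F21, F31⟩ : F 2 1 = 0 ∧ F 3 1 = 0 := oF 1 zE E31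
  have F10 : F 1 0 = 0 := by rw [kF 1 0 (by decide) (by decide), E10]
  have F00 : 0 ≤ F 0 0 := by rw [kF 0 0 (by decide) (by decide)]; exact E00
  have F11 : 0 ≤ F 1 1 := by rw [kF 1 1 (by decide) (by decide)]; exact pE
  rw [eq_one_of_upperTriangular hF dF F10 F20 F30 F21 F31 zF F00 F11 pF]
  convert one_mem_magicLocal
  simp

/-! ### Diagonalization of symmetric unitary matrices -/

theorem exists_perm_of_map_univ_eq {ι α : Type*} [Fintype ι] {f g : ι → α}
    (h : Finset.univ.val.map f = Finset.univ.val.map g) : ∃ σ : Equiv.Perm ι, f = g ∘ σ := by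
  classical
  have hc : ∀ c, Nonempty ({i // f i = c} ≃ {i // g i = c}) := by
    intro c
    refine ⟨Fintype.equivOfCardEq ?_⟩
    have h1 := congrArg (Multiset.count c) h
    rw [Multiset.count_map, Multiset.count_map] at h1
    rw [Fintype.card_subtype, Fintype.card_subtype, Finset.card_def, Finset.card_def]
    simpa [eq_comm] using h1
  refine ⟨Equiv.ofFiberEquiv fun c => (hc c).some, ?_⟩
  funext i
  exact (Equiv.ofFiberEquiv_map _ i).symm

/-- Commuting real symmetric matrices have a common orthonormal eigenbasis. -/
theorem exists_orthogonal_diagonalizing {n : ℕ} {A B : Matrix (Fin n) (Fin n) ℝ}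
    (hA : A.IsSymm) (hB : B.IsSymm) (hAB : A * B = B * A) :
    ∃ O : Matrix (Fin n) (Fin n) ℝ, Oᵀ * O = 1 ∧ ∃ α β : Fin n → ℝ,
      A * O = O * Matrix.diagonal α ∧ B * O = O * Matrix.diagonal β := by
  classical
  have sA : (Matrix.toEuclideanLin A).IsSymmetric :=
    Matrix.isSymmetric_toEuclideanLin_iff.2 (by simpa [Matrix.IsHermitian] using hA.eq)
  have sB : (Matrix.toEuclideanLin B).IsSymmetric :=
    Matrix.isSymmetric_toEuclideanLin_iff.2 (by simpa [Matrix.IsHermitian] using hB.eq)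
  have hcomm : Commute (Matrix.toEuclideanLin A) (Matrix.toEuclideanLin B) := by
    refine LinearMap.ext fun v => ?_
    rw [Module.End.mul_apply, Module.End.mul_apply]
    change WithLp.toLp 2 (A *ᵥ (B *ᵥ v.ofLp)) = WithLp.toLp 2 (B *ᵥ (A *ᵥ v.ofLp))
    rw [Matrix.mulVec_mulVec, Matrix.mulVec_mulVec, hAB]
  have hint := LinearMap.IsSymmetric.directSum_isInternal_of_commute sA sB hcomm
  have hfam := LinearMap.IsSymmetric.orthogonalFamily_eigenspace_inf_eigenspace sA sB
  set b := hint.collectedBasis fun i => (stdOrthonormalBasis ℝ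
    (Module.End.eigenspace (Matrix.toEuclideanLin A) i.2 ⊓
      Module.End.eigenspace (Matrix.toEuclideanLin B) i.1 :
        Submodule ℝ (EuclideanSpace ℝ (Fin n)))).toBasis with hb
  have hortho : Orthonormal ℝ b :=
    hint.collectedBasis_orthonormal hfam fun i => by
      rw [OrthonormalBasis.coe_toBasis]
      exact OrthonormalBasis.orthonormal _
  let e := b.indexEquiv (EuclideanSpace.basisFun (Fin n) ℝ).toBasis
  have hmem := fun j => hint.collectedBasis_mem (fun i => (stdOrthonormalBasis ℝ
    (Module.End.eigenspace (Matrix.toEuclideanLin A) i.2 ⊓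
      Module.End.eigenspace (Matrix.toEuclideanLin B) i.1 :
        Submodule ℝ (EuclideanSpace ℝ (Fin n)))).toBasis) (e.symm j)
  rw [← hb] at hmem
  clear_value b
  refine ⟨Matrix.of fun i j => b (e.symm j) i, ?_, fun j => (e.symm j).1.2,
    fun j => (e.symm j).1.1, ?_, ?_⟩
  · ext i j
    have h1 := (orthonormal_iff_ite.1 hortho) (e.symm i) (e.symm j)
    simp only [EmbeddingLike.apply_eq_iff_eq] at h1
    rw [Matrix.one_apply, ← h1, Matrix.mul_apply]
    rw [PiLp.inner_apply]
    exact Finset.sum_congr rfl fun k _ => mul_comm _ _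
  · ext i j
    have h1 := Module.End.mem_eigenspace_iff.1 (hmem j).1
    rw [Matrix.mul_diagonal]
    exact (congrFun (congrArg WithLp.ofLp h1) i).trans (mul_comm _ _)
  · ext i j
    have h1 := Module.End.mem_eigenspace_iff.1 (hmem j).2
    rw [Matrix.mul_diagonal]
    exact (congrFun (congrArg WithLp.ofLp h1) i).trans (mul_comm _ _)

theorem map_ofReal_injective {M N : Matrix (Fin 4) (Fin 4) ℝ}
    (h : M.map Complex.ofReal = N.map Complex.ofReal) : M = N :=
  Matrix.map_injective Complex.ofReal_injective h

theorem map_ofReal_one : (1 : Matrix (Fin 4) (Fin 4) ℝ).map Complex.ofReal = 1 := by simp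

theorem roots_charpoly_diagonal (d : Fin 4 → ℂ) :
    (Matrix.diagonal d).charpoly.roots = Finset.univ.val.map d := by
  rw [Matrix.charpoly_diagonal]
  have h := Polynomial.roots_multiset_prod_X_sub_C (Finset.univ.val.map d)
  rwa [Multiset.map_map] at h

/-- A symmetric unitary matrix is diagonalized by a rotation, with the eigenvalues in any prescribed
order: its real and imaginary parts are commuting real symmetric matrices. -/
theorem exists_rotation_diagonalizing {M : Matrix (Fin 4) (Fin 4) ℂ} (hM : Mᵀ = M)
    (hu : M ∈ Matrix.unitaryGroup (Fin 4) ℂ) {z : Fin 4 → ℂ}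
    (hz : M.charpoly.roots = Finset.univ.val.map z) :
    ∃ O : Matrix (Fin 4) (Fin 4) ℝ, Oᵀ * O = 1 ∧ O.det = 1 ∧
      M * O.map Complex.ofReal = O.map Complex.ofReal * Matrix.diagonal z := by
  set A : Matrix (Fin 4) (Fin 4) ℝ := M.map Complex.re with hA
  set B : Matrix (Fin 4) (Fin 4) ℝ := M.map Complex.im with hB
  have sA : A.IsSymm := by
    rw [Matrix.IsSymm, hA, ← Matrix.transpose_map, hM]
  have sB : B.IsSymm := by
    rw [Matrix.IsSymm, hB, ← Matrix.transpose_map, hM]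
  have hMAB : M = A.map Complex.ofReal + Complex.I • B.map Complex.ofReal := by
    ext i j
    simp [hA, hB, mul_comm Complex.I, Complex.re_add_im]
  have hstar : Mᴴ = A.map Complex.ofReal - Complex.I • B.map Complex.ofReal := by
    rw [← hM]
    ext i j
    apply Complex.ext <;> simp [hA, hB]
  have hAB : A * B = B * A := by
    have h1 := Matrix.mem_unitaryGroup_iff.1 hu
    have h2 := Matrix.mem_unitaryGroup_iff'.1 hu
    rw [Matrix.star_eq_conjTranspose, hstar, hMAB] at h1 h2
    apply map_ofReal_injective
    rw [map_ofReal_mul, map_ofReal_mul]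
    have h3 := h1.trans h2.symm
    simp only [mul_add, add_mul, mul_sub, sub_mul, Matrix.mul_smul, Matrix.smul_mul] at h3
    have h4 : (2 * Complex.I) • (B.map Complex.ofReal * A.map Complex.ofReal) =
        (2 * Complex.I) • (A.map Complex.ofReal * B.map Complex.ofReal) := by
      ext i j
      have h5 := congrFun (congrFun h3 i) j
      simp only [Matrix.add_apply, Matrix.sub_apply, Matrix.smul_apply, smul_eq_mul] at h5 ⊢
      linear_combination h5
    exact (smul_right_injective _ (by simp) h4).symm
  obtain ⟨O, hO, α, β, hα, hβ⟩ := exists_orthogonal_diagonalizing sA sB hAB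
  set d : Fin 4 → ℂ := fun j => α j + Complex.I * β j with hd
  have hOd : M * O.map Complex.ofReal = O.map Complex.ofReal * Matrix.diagonal d := by
    have : Matrix.diagonal d = (Matrix.diagonal α).map Complex.ofReal +
        Complex.I • (Matrix.diagonal β).map Complex.ofReal := by
      ext i j
      by_cases hij : i = j
      · subst hij; simp [hd]
      · simp [hij]
    rw [this, hMAB, add_mul, mul_add, Matrix.smul_mul, Matrix.mul_smul, ← map_ofReal_mul,
      ← map_ofReal_mul, ← map_ofReal_mul, ← map_ofReal_mul, hα, hβ]
  have hOO : (O.map Complex.ofReal)ᵀ * O.map Complex.ofReal = 1 := by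
    rw [← Matrix.transpose_map, ← map_ofReal_mul, hO, map_ofReal_one]
  have hroots : M.charpoly.roots = Finset.univ.val.map d := by
    have h1 : M = O.map Complex.ofReal * (Matrix.diagonal d * (O.map Complex.ofReal)ᵀ) := by
      rw [← Matrix.mul_assoc, ← hOd, Matrix.mul_assoc, mul_eq_one_comm.1 hOO, Matrix.mul_one]
    have h2 : M.charpoly = (Matrix.diagonal d).charpoly := by
      rw [h1, Matrix.charpoly_mul_comm, Matrix.mul_assoc, hOO, Matrix.mul_one]
    rw [h2, roots_charpoly_diagonal]
  obtain ⟨σ, hσ⟩ := exists_perm_of_map_univ_eq (hz.symm.trans hroots)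
  set P := O.submatrix id σ with hP
  have hPP : Pᵀ * P = 1 := by
    rw [hP, Matrix.transpose_submatrix, ← Matrix.submatrix_mul _ _ _ id _ Function.bijective_id, hO,
      Matrix.submatrix_one_equiv]
  have hPz : M * P.map Complex.ofReal = P.map Complex.ofReal * Matrix.diagonal z := by
    ext i j
    have h1 := congrFun (congrFun hOd i) (σ j)
    rw [Matrix.mul_diagonal] at h1 ⊢
    rw [hσ]
    exact h1
  have hdet : P.det * P.det = 1 := by
    have := congrArg Matrix.det hPP
    rwa [Matrix.det_mul, Matrix.det_transpose, Matrix.det_one] at this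
  rcases mul_self_eq_one_iff.1 hdet with h | h
  · exact ⟨P, hPP, h, hPz⟩
  -- change the sign of one eigenvector
  · set S : Matrix (Fin 4) (Fin 4) ℝ := Matrix.diagonal ![-1, 1, 1, 1] with hS
    have hSS : Sᵀ * S = 1 := by
      rw [hS, Matrix.diagonal_transpose, Matrix.diagonal_mul_diagonal, ← Matrix.diagonal_one]
      congr 1
      funext j
      fin_cases j <;> simp
    refine ⟨P * S, ?_, ?_, ?_⟩
    · rw [Matrix.transpose_mul, Matrix.mul_assoc, ← Matrix.mul_assoc Pᵀ, hPP, Matrix.one_mul, hSS]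
    · rw [Matrix.det_mul, h, hS, Matrix.det_diagonal]
      simp [Fin.prod_univ_four]
    · have hSz : S.map Complex.ofReal * Matrix.diagonal z =
          Matrix.diagonal z * S.map Complex.ofReal := by
        rw [hS, Matrix.diagonal_map (by simp), Matrix.diagonal_mul_diagonal,
          Matrix.diagonal_mul_diagonal]
        congr 1
        funext j
        exact mul_comm _ _
      rw [map_ofReal_mul, ← Matrix.mul_assoc, hPz, Matrix.mul_assoc, Matrix.mul_assoc, hSz]

/-! ### The Cartan decomposition -/

theorem transpose_magicQ_mul : magicQᵀ * magicQᴴᵀ = 1 := by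
  rw [← Matrix.transpose_mul, magicQ_mul, Matrix.transpose_one]

theorem diagonal_exp_mem (θ : Fin 4 → ℝ) :
    Matrix.diagonal (fun j => Complex.exp (θ j * Complex.I)) ∈ Matrix.unitaryGroup (Fin 4) ℂ := by
  rw [Matrix.mem_unitaryGroup_iff, Matrix.star_eq_conjTranspose, Matrix.diagonal_conjTranspose,
    Matrix.diagonal_mul_diagonal, ← Matrix.diagonal_one]
  congr 1
  funext j
  rw [Pi.star_apply, Complex.star_def, Complex.mul_conj', Complex.norm_exp_ofReal_mul_I]
  simp

/-- The operator with eigenvalues `e^{iθ₀}, …, e^{iθ₃}` on the magic basis. -/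
def magicDiagonal (θ : Fin 4 → ℝ) : U4 :=
  ⟨magicQ * Matrix.diagonal (fun j => Complex.exp (θ j * Complex.I)) * magicQᴴ,
    mul_mem (mul_mem magicQ_mem (diagonal_exp_mem θ)) (Unitary.star_mem magicQ_mem)⟩

theorem magic_conj_mul (M N : Matrix (Fin 4) (Fin 4) ℂ) :
    magicQᴴ * (M * N) * magicQ = (magicQᴴ * M * magicQ) * (magicQᴴ * N * magicQ) := by
  calc _ = magicQᴴ * M * 1 * N * magicQ := by simp [Matrix.mul_assoc]
    _ = _ := by
        rw [← magicQ_mul']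
        simp only [Matrix.mul_assoc]

theorem magic_conj_conj (M : Matrix (Fin 4) (Fin 4) ℂ) :
    magicQᴴ * (magicQ * M * magicQᴴ) * magicQ = M := by
  calc _ = (magicQᴴ * magicQ) * M * (magicQᴴ * magicQ) := by simp only [Matrix.mul_assoc]
    _ = _ := by rw [magicQ_mul, Matrix.one_mul, Matrix.mul_one]

theorem magic_conj_conj' (M : Matrix (Fin 4) (Fin 4) ℂ) :
    magicQ * (magicQᴴ * M * magicQ) * magicQᴴ = M := by
  calc _ = (magicQ * magicQᴴ) * M * (magicQ * magicQᴴ) := by simp only [Matrix.mul_assoc]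
    _ = _ := by rw [magicQ_mul', Matrix.one_mul, Matrix.mul_one]

theorem det_magic_conj (M : Matrix (Fin 4) (Fin 4) ℂ) :
    (magicQᴴ * M * magicQ).det = M.det := by
  rw [Matrix.det_mul, Matrix.det_mul, mul_right_comm, ← Matrix.det_mul, magicQ_mul, Matrix.det_one,
    one_mul]

theorem magic_conj_magicDiagonal (θ : Fin 4 → ℝ) :
    magicQᴴ * (magicDiagonal θ).1 * magicQ =
      Matrix.diagonal (fun j => Complex.exp (θ j * Complex.I)) :=
  magic_conj_conj _

theorem det_magicDiagonal {θ : Fin 4 → ℝ} (h : ∑ j, θ j = 0) : (magicDiagonal θ).1.det = 1 := by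
  rw [← det_magic_conj, magic_conj_magicDiagonal, Matrix.det_diagonal, ← Complex.exp_sum,
    ← Finset.sum_mul, ← Complex.ofReal_sum, h]
  simp

theorem cartanDouble_magicDiagonal (θ : Fin 4 → ℝ) : cartanDouble (magicDiagonal θ).1 =
    Matrix.diagonal (fun j => Complex.exp ((2 * θ j : ℝ) * Complex.I)) := by
  rw [cartanDouble, magic_conj_magicDiagonal, Matrix.diagonal_transpose,
    Matrix.diagonal_mul_diagonal]
  congr 1
  funext j
  rw [← Complex.exp_add]
  congr 1
  push_cast
  ring

/-- A matrix that is both unitary and complex orthogonal is real. -/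
theorem eq_map_ofReal_of_mul_transpose {N : Matrix (Fin 4) (Fin 4) ℂ}
    (hN : N ∈ Matrix.unitaryGroup (Fin 4) ℂ) (h : N * Nᵀ = 1) :
    ∃ R : Matrix (Fin 4) (Fin 4) ℝ, Rᵀ * R = 1 ∧ N = R.map Complex.ofReal := by
  have h1 : Nᴴ = Nᵀ := by
    have h2 := Matrix.mem_unitaryGroup_iff'.1 hN
    calc Nᴴ = Nᴴ * (N * Nᵀ) := by rw [h, Matrix.mul_one]
      _ = Nᵀ := by rw [← Matrix.mul_assoc]; erw [h2]; rw [Matrix.one_mul]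
  have h3 : N = (N.map Complex.re).map Complex.ofReal := by
    ext i j
    have h4 := congrFun (congrFun h1 j) i
    exact (Complex.conj_eq_iff_re.1 h4).symm
  refine ⟨N.map Complex.re, ?_, h3⟩
  apply map_ofReal_injective
  rw [map_ofReal_mul, Matrix.transpose_map, ← h3, map_ofReal_one]
  exact mul_eq_one_comm.1 h

theorem det_map_ofReal (R : Matrix (Fin 4) (Fin 4) ℝ) :
    (R.map Complex.ofReal).det = (R.det : ℂ) :=
  (RingHom.map_det Complex.ofRealHom R).symm

/-- The Cartan decomposition: an operator is, up to local gates, diagonal in the magic basis, with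
half the logarithmic spectrum of its Cartan double, in any order, as eigenphases. -/
theorem exists_cartan_decomposition {V : U4} (hV : V.1.det = 1) {b : EuclideanSpace ℝ (Fin 4)}
    (hb : ∑ j, b j = 0) (h : HasLogSpec (cartanDouble V) b) :
    ∃ l₁ ∈ localGates, ∃ l₂ ∈ localGates,
      (V : PU4) = l₁ * (magicDiagonal fun j => π * b j : U4) * l₂ := by
  obtain ⟨O, hO, hOd, hOz⟩ := exists_rotation_diagonalizing (M := cartanDouble V)
    (by rw [cartanDouble, Matrix.transpose_mul, Matrix.transpose_transpose]) (cartanDouble_mem V) h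
  set W := magicQᴴ * V.1 * magicQ with hW
  set C := O.map Complex.ofReal with hC
  set D := Matrix.diagonal (fun j => Complex.exp ((π * b j : ℝ) * Complex.I)) with hD
  have hDu : D ∈ Matrix.unitaryGroup (Fin 4) ℂ := diagonal_exp_mem fun j => π * b j
  have hDD : D * D = Matrix.diagonal fun j => Complex.exp (2 * π * Complex.I * (b j : ℂ)) := by
    rw [hD, Matrix.diagonal_mul_diagonal]
    congr 1
    funext j
    rw [← Complex.exp_add]
    congr 1
    push_cast
    ring
  have hD1 : D * Dᴴ = 1 := Matrix.mem_unitaryGroup_iff.1 hDu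
  have hD2 : Dᴴ * D = 1 := Matrix.mem_unitaryGroup_iff'.1 hDu
  have hDt : Dᴴᵀ = Dᴴ := by
    rw [hD, Matrix.diagonal_conjTranspose, Matrix.diagonal_transpose]
  have hC1 : Cᵀ * C = 1 := by
    rw [hC, ← Matrix.transpose_map, ← map_ofReal_mul, hO, map_ofReal_one]
  have hC2 : C * Cᵀ = 1 := mul_eq_one_comm.1 hC1
  have hCt : Cᴴ = Cᵀ := by
    ext i j
    simp [hC]
  set N := Dᴴ * Cᵀ * W with hN
  have hNN : N * Nᵀ = 1 := by
    calc N * Nᵀ = Dᴴ * Cᵀ * ((W * Wᵀ) * C) * Dᴴ := by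
          rw [hN, Matrix.transpose_mul (Dᴴ * Cᵀ) W, Matrix.transpose_mul Dᴴ Cᵀ, hDt,
            Matrix.transpose_transpose]
          simp only [Matrix.mul_assoc]
      _ = Dᴴ * (Cᵀ * C) * (D * D) * Dᴴ := by
          rw [show W * Wᵀ * C = _ from hOz, hDD]
          simp only [Matrix.mul_assoc]
      _ = (Dᴴ * D) * (D * Dᴴ) := by
          rw [hC1, Matrix.mul_one]
          simp only [Matrix.mul_assoc]
      _ = 1 := by rw [hD1, hD2, Matrix.mul_one]
  have hWu : W ∈ Matrix.unitaryGroup (Fin 4) ℂ :=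
    mul_mem (mul_mem (Unitary.star_mem magicQ_mem) V.2) magicQ_mem
  have hCu : Cᵀ ∈ Matrix.unitaryGroup (Fin 4) ℂ := by
    rw [← hCt]
    refine Unitary.star_mem (Matrix.mem_unitaryGroup_iff.2 ?_)
    rw [Matrix.star_eq_conjTranspose, hCt, hC2]
  obtain ⟨R, hR, hNR⟩ := eq_map_ofReal_of_mul_transpose
    (mul_mem (mul_mem (Unitary.star_mem hDu) hCu) hWu) hNN
  change N = _ at hNR
  have hRd : R.det = 1 := by
    have h1 : D.det = 1 := by
      rw [hD, Matrix.det_diagonal, ← Complex.exp_sum, ← Finset.sum_mul, ← Complex.ofReal_sum,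
        ← Finset.mul_sum, hb]
      simp
    have h2 : N.det = 1 := by
      rw [hN, Matrix.det_mul, Matrix.det_mul, Matrix.det_conjTranspose, h1, Matrix.det_transpose,
        hC, det_map_ofReal, hOd, hW, det_magic_conj, hV]
      simp
    rw [hNR, det_map_ofReal] at h2
    exact_mod_cast h2
  have hWCDN : W = C * D * N := by
    calc W = C * (D * Dᴴ) * Cᵀ * W := by rw [hD1, Matrix.mul_one, hC2, Matrix.one_mul]
      _ = _ := by rw [hN]; simp only [Matrix.mul_assoc]
  obtain ⟨A₁, B₁, h₁⟩ := mem_magicLocal_of_orthogonal hO hOd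
  obtain ⟨A₂, B₂, h₂⟩ := mem_magicLocal_of_orthogonal hR hRd
  refine ⟨_, ⟨A₁, B₁, rfl⟩, _, ⟨A₂, B₂, rfl⟩, ?_⟩
  rw [← QuotientGroup.mk_mul, ← QuotientGroup.mk_mul]
  congr 1
  apply Subtype.ext
  rw [← magic_conj_conj' V.1, ← magic_conj_conj' (tensor A₁ B₁ * _ * tensor A₂ B₂ : U4).1]
  congr 2
  rw [Submonoid.coe_mul, Submonoid.coe_mul, magic_conj_mul, magic_conj_mul, h₁, h₂,
    magic_conj_magicDiagonal, ← hNR]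
  exact hWCDN

/-! ### Circuits with controlled-`Z` gates -/

/-- The Hadamard gate. -/
def hadamard : Matrix.unitaryGroup (Fin 2) ℂ :=
  ⟨((√2 : ℝ) : ℂ)⁻¹ • !![1, 1; 1, -1], by
    rw [Matrix.mem_unitaryGroup_iff, star_smul, Matrix.smul_mul, Matrix.mul_smul, smul_smul,
      Complex.star_def, ← Complex.ofReal_inv, Complex.conj_ofReal, Complex.ofReal_inv,
      inv_sqrt_two_mul_self]
    have h : star !![(1 : ℂ), 1; 1, -1] = !![1, 1; 1, -1] := by
      ext i j
      fin_cases i <;> fin_cases j <;> simp [Matrix.star_apply]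
    rw [h, Matrix.mul_fin_two]
    ext i j
    fin_cases i <;> fin_cases j <;> simp <;> norm_num⟩

theorem tensor_one_hadamard : (tensor 1 hadamard).1 = ((√2 : ℝ) : ℂ)⁻¹ •
    !![1, 1, 0, 0; 1, -1, 0, 0; 0, 0, 1, 1; 0, 0, 1, -1] := by
  rw [tensor_eq]
  ext i j
  fin_cases i <;> fin_cases j <;> simp [hadamard]

theorem one_mem_localGates : (1 : PU4) ∈ localGates := ⟨1, 1, by rw [tensor_one]; rfl⟩

theorem mul_mem_localGates {k l : PU4} (hk : k ∈ localGates) (hl : l ∈ localGates) :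
    k * l ∈ localGates := by
  obtain ⟨A, B, rfl⟩ := hk
  obtain ⟨C, D, rfl⟩ := hl
  exact ⟨A * C, B * D, by rw [← tensor_mul]; rfl⟩

theorem inv_mem_localGates {k : PU4} (hk : k ∈ localGates) : k⁻¹ ∈ localGates := by
  obtain ⟨A, B, rfl⟩ := hk
  refine ⟨A⁻¹, B⁻¹, inv_eq_of_mul_eq_one_right ?_⟩
  rw [← QuotientGroup.mk_mul, tensor_mul, mul_inv_cancel, mul_inv_cancel, tensor_one]
  rfl

theorem local_mul_mem_programs {S : Set PU4} {n : ℕ} {k u : PU4} (hk : k ∈ localGates)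
    (hu : u ∈ programs S n) : k * u ∈ programs S n := by
  cases n with
  | zero => exact mul_mem_localGates hk hu
  | succ n =>
    obtain ⟨l, hl, s, hs, p, hp, rfl⟩ := hu
    exact ⟨k * l, mul_mem_localGates hk hl, s, hs, p, hp, by simp only [mul_assoc]⟩

theorem mul_local_mem_programs {S : Set PU4} {n : ℕ} {k u : PU4} (hk : k ∈ localGates)
    (hu : u ∈ programs S n) : u * k ∈ programs S n := by
  induction n generalizing u with
  | zero => exact mul_mem_localGates hu hk
  | succ n ih =>
    obtain ⟨l, hl, s, hs, p, hp, rfl⟩ := hu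
    exact ⟨l, hl, s, hs, p * k, ih hp, by simp only [mul_assoc]⟩

theorem programs_mono {S T : Set PU4} (h : S ⊆ T) (n : ℕ) : programs S n ⊆ programs T n := by
  induction n with
  | zero => exact subset_rfl
  | succ n ih =>
    rintro _ ⟨l, hl, s, hs, p, hp, rfl⟩
    exact ⟨l, hl, s, h hs, p, ih hp, rfl⟩

theorem programs_subset_succ {S : Set PU4} (h : (1 : PU4) ∈ S) (n : ℕ) :
    programs S n ⊆ programs S (n + 1) :=
  fun u hu => ⟨1, one_mem_localGates, 1, h, u, hu, by simp⟩

theorem cz_mul_tensor_mul_cz (u v u' w : ℝ) (h : u ^ 2 + v ^ 2 = 1) (h' : u' ^ 2 + w ^ 2 = 1) :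
    cz.1 * (tensor (xRot u v h) (xRot u' w h')).1 * cz.1 =
      !![(u * u' : ℂ), u * w * Complex.I, v * u' * Complex.I, v * w;
        u * w * Complex.I, u * u', -(v * w), -(v * u' * Complex.I);
        v * u' * Complex.I, -(v * w), u * u', -(u * w * Complex.I);
        v * w, -(v * u' * Complex.I), -(u * w * Complex.I), u * u'] := by
  rw [tensor_xRot, cz]
  ext i j
  fin_cases i <;> fin_cases j <;> simp

/-- Two controlled-`Z` gates with `X`-rotations in between produce the commuting rotations generated
by `X ⊗ Z` and `Z ⊗ X`, which are diagonal in the magic basis up to a Hadamard gate. -/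
theorem magicDiagonal_eq_circuit (α β : ℝ) : ∃ A B : Matrix.unitaryGroup (Fin 2) ℂ,
    magicDiagonal ![α + β, α - β, -(α + β), -(α - β)] =
      tensor 1 hadamard * (cz * tensor A B * cz) * tensor 1 hadamard := by
  refine ⟨xRot (Real.cos α) (Real.sin α) (Real.cos_sq_add_sin_sq α),
    xRot (Real.cos β) (Real.sin β) (Real.cos_sq_add_sin_sq β), ?_⟩
  have e : ∀ x : ℝ, Complex.exp (x * Complex.I) = Real.cos x + Real.sin x * Complex.I := by
    intro x
    rw [Complex.exp_mul_I, Complex.ofReal_cos, Complex.ofReal_sin]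
  have hD : Matrix.diagonal (fun j => Complex.exp
      ((![α + β, α - β, -(α + β), -(α - β)] j : ℝ) * Complex.I)) =
      !![Complex.exp ((α + β : ℝ) * Complex.I), 0, 0, 0;
        0, Complex.exp ((α - β : ℝ) * Complex.I), 0, 0;
        0, 0, Complex.exp ((-(α + β) : ℝ) * Complex.I), 0;
        0, 0, 0, Complex.exp ((-(α - β) : ℝ) * Complex.I)] := by
    ext i j
    fin_cases i <;> fin_cases j <;> rfl
  have key : (tensor 1 hadamard * (cz * tensor (xRot (Real.cos α) (Real.sin α)
      (Real.cos_sq_add_sin_sq α)) (xRot (Real.cos β) (Real.sin β)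
      (Real.cos_sq_add_sin_sq β)) * cz) * tensor 1 hadamard : U4).1 * magicQ =
      magicQ * Matrix.diagonal (fun j => Complex.exp
      ((![α + β, α - β, -(α + β), -(α - β)] j : ℝ) * Complex.I)) := by
    simp only [Submonoid.coe_mul]
    rw [cz_mul_tensor_mul_cz, tensor_one_hadamard, hD]
    simp only [Matrix.smul_mul, Matrix.mul_smul, smul_smul, inv_sqrt_two_mul_self, e,
      Real.cos_neg, Real.sin_neg, Real.cos_add, Real.cos_sub, Real.sin_add, Real.sin_sub]
    generalize Real.cos α = a
    generalize Real.sin α = b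
    generalize Real.cos β = c
    generalize Real.sin β = d
    rw [magicQ, Matrix.smul_mul, Matrix.mul_smul, smul_comm]
    congr 1
    simp only [mul_fin_four]
    ext i j
    fin_cases i <;> fin_cases j <;> simp <;> ring
  apply Subtype.ext
  calc _ = magicQ * Matrix.diagonal _ * magicQᴴ := rfl
    _ = _ := by rw [← key, Matrix.mul_assoc, magicQ_mul', Matrix.mul_one]

theorem trace_cartanDouble_cz_hadamard (θ : Fin 4 → ℝ) :
    (cartanDouble (cz * tensor 1 hadamard * magicDiagonal θ : U4).1).trace = 0 := by
  set D := Matrix.diagonal (fun j => Complex.exp (θ j * Complex.I)) with hD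
  set S := (cz * tensor 1 hadamard : U4).1 with hS
  have hDt : Dᵀ = D := by rw [hD, Matrix.diagonal_transpose]
  have h1 : (cartanDouble (cz * tensor 1 hadamard * magicDiagonal θ : U4).1).trace =
      (D * D * (magicQᵀ * (Sᵀ * spinFlip * S) * magicQ)).trace := by
    rw [trace_cartanDouble, Submonoid.coe_mul, ← hS,
      show (magicDiagonal θ).1 = magicQ * D * magicQᴴ from rfl, ← magicQ_mul_transpose]
    simp only [Matrix.transpose_mul, hDt]
    calc _ = (S * magicQ * D * (magicQᴴ * magicQ) * (magicQᵀ * magicQᴴᵀ) * D * magicQᵀ * Sᵀ *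
          (magicQ * magicQᵀ)).trace := by simp only [Matrix.mul_assoc]
      _ = (S * (magicQ * (D * (D * (magicQᵀ * (Sᵀ * (magicQ * magicQᵀ))))))).trace := by
        rw [magicQ_mul, transpose_magicQ_mul]
        simp only [Matrix.mul_one, Matrix.mul_assoc]
      _ = _ := by
        rw [Matrix.trace_mul_comm, Matrix.mul_assoc magicQ, Matrix.trace_mul_comm]
        simp only [Matrix.mul_assoc]
  have h2 : ∀ j, (magicQᵀ * (Sᵀ * spinFlip * S) * magicQ) j j = 0 := by
    have h3 : S = ((√2 : ℝ) : ℂ)⁻¹ • !![1, 1, 0, 0; 1, -1, 0, 0; 0, 0, 1, 1; 0, 0, -1, 1] := by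
      rw [hS, Submonoid.coe_mul, tensor_one_hadamard, Matrix.mul_smul, cz, mul_fin_four]
      simp
    have h4 : Sᵀ * spinFlip * S = !![0, 0, -1, 0; 0, 0, 0, 1; -1, 0, 0, 0; 0, 1, 0, 0] := by
      rw [h3, Matrix.transpose_smul, Matrix.smul_mul, Matrix.smul_mul, Matrix.mul_smul, smul_smul,
        inv_sqrt_two_mul_self]
      ext i j
      fin_cases i <;> fin_cases j <;>
        simp [spinFlip, Matrix.mul_apply, Fin.sum_univ_four] <;> norm_num
    intro j
    rw [h4]
    fin_cases j <;> simp [magicQ, Matrix.mul_apply, Fin.sum_univ_four]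
  rw [h1, hD, Matrix.diagonal_mul_diagonal, Matrix.trace]
  refine Finset.sum_eq_zero fun j _ => ?_
  rw [Matrix.diag_apply, Matrix.diagonal_mul, h2, mul_zero]

/-! ### Programs with two and three gates -/

theorem isMonodromy_monodromy (u : PU4) : IsMonodromy u (monodromy u) :=
  (exists_isMonodromy u).choose_spec

theorem monodromy_eq {u : PU4} {a : EuclideanSpace ℝ (Fin 4)} (h : IsMonodromy u a) :
    monodromy u = a :=
  isMonodromy_unique (isMonodromy_monodromy u) h

/-- Every point of `alcoveC2` is attained by the map `Π`. -/
theorem isMonodromy_magicDiagonal {a : EuclideanSpace ℝ (Fin 4)} (ha : a ∈ alcoveC2) :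
    IsMonodromy (magicDiagonal fun j => π * a j : U4) a := by
  refine ⟨ha, _, det_magicDiagonal ?_, rfl, ?_⟩
  · rw [← Finset.mul_sum, ha.1.2.2, mul_zero]
  · rw [HasLogSpec, cartanDouble_magicDiagonal, roots_charpoly_diagonal]
    congr 1
    funext j
    congr 1
    push_cast
    ring

theorem cz_mem_cphaseGates : ((cz : U4) : PU4) ∈ cphaseGates := by
  refine ⟨π, Real.pi_pos.le, by linarith [Real.pi_pos], ?_⟩
  congr 1
  apply Subtype.ext
  simp only [cz, cphase, Complex.exp_pi_mul_I]
  ext i j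
  fin_cases i <;> fin_cases j <;> rfl

theorem one_mem_cphaseGates : (1 : PU4) ∈ cphaseGates := by
  refine ⟨0, le_rfl, by positivity, ?_⟩
  have h : cphase 0 = 1 := by
    apply Subtype.ext
    simp only [cphase, Complex.ofReal_zero, zero_mul, Complex.exp_zero]
    ext i j
    fin_cases i <;> fin_cases j <;> rfl
  rw [h]
  rfl

theorem czGates_subset_cphaseGates : czGates ⊆ cphaseGates := by
  rintro _ rfl
  exact cz_mem_cphaseGates

theorem mem_triangle_of_mem_programs {u : PU4} (hu : u ∈ programs cphaseGates 2)
    {a : EuclideanSpace ℝ (Fin 4)} (h : IsMonodromy u a) : a ∈ triangle := by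
  obtain ⟨ha, V, hV, rfl, hs⟩ := h
  exact (mem_triangle_iff_trace_real ha hs).2 (trace_real_of_mem_programs hV hu)

theorem mem_programs_cz_of_mem_triangle {u : PU4} {a : EuclideanSpace ℝ (Fin 4)}
    (h : IsMonodromy u a) (ht : a ∈ triangle) : u ∈ programs czGates 2 := by
  obtain ⟨ha, V, hV, rfl, hs⟩ := h
  obtain ⟨-, -, -, h2, h3⟩ := mem_triangle_iff.1 ht
  -- the order of the eigenphases in `magicDiagonal_eq_circuit`
  have hs' : HasLogSpec (cartanDouble V) !₂[a 0, a 1, -a 0, -a 1] := by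
    have huniv : ∀ f : Fin 4 → ℂ, Finset.univ.val.map f = {f 0, f 1, f 2, f 3} := by
      intro f; rfl
    rw [HasLogSpec, hs, huniv, huniv, h2, h3]
    simp only [Multiset.insert_eq_cons, ← Multiset.singleton_add]
    change _ = {Complex.exp (2 * π * Complex.I * (a 0 : ℂ))} +
      ({Complex.exp (2 * π * Complex.I * (a 1 : ℂ))} +
        ({Complex.exp (2 * π * Complex.I * ((-a 0 : ℝ) : ℂ))} +
          {Complex.exp (2 * π * Complex.I * ((-a 1 : ℝ) : ℂ))}))
    abel
  obtain ⟨l₁, hl₁, l₂, hl₂, hV'⟩ := exists_cartan_decomposition hV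
    (by simp [Fin.sum_univ_four]) hs'
  obtain ⟨A, B, hAB⟩ := magicDiagonal_eq_circuit (π * (a 0 + a 1) / 2) (π * (a 0 - a 1) / 2)
  have e : (fun j => π * (!₂[a 0, a 1, -a 0, -a 1] : EuclideanSpace ℝ (Fin 4)) j) =
      ![π * (a 0 + a 1) / 2 + π * (a 0 - a 1) / 2, π * (a 0 + a 1) / 2 - π * (a 0 - a 1) / 2,
        -(π * (a 0 + a 1) / 2 + π * (a 0 - a 1) / 2),
        -(π * (a 0 + a 1) / 2 - π * (a 0 - a 1) / 2)] := by
    funext j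
    fin_cases j <;> simp <;> ring
  rw [e, hAB] at hV'
  rw [hV']
  refine mul_local_mem_programs hl₂ (local_mul_mem_programs hl₁ ?_)
  exact ⟨_, ⟨1, hadamard, rfl⟩, _, rfl, _, ⟨_, ⟨A, B, rfl⟩, _, rfl, _, ⟨1, hadamard, rfl⟩, rfl⟩,
    by simp [mul_assoc]⟩

/-- The signs by which the lifts of a class change the Cartan double do not affect the reality of
its trace. -/
theorem mem_programs_cz_of_trace_real {V : U4} (hV : V.1.det = 1)
    (h : (cartanDouble V).trace.im = 0) : (V : PU4) ∈ programs czGates 2 := by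
  obtain ⟨a, ha⟩ := exists_isMonodromy (V : PU4)
  refine mem_programs_cz_of_mem_triangle ha ?_
  obtain ⟨ha, W, hW, hWV, hs⟩ := ha
  refine (mem_triangle_iff_trace_real ha hs).2 ?_
  obtain ⟨c, hc⟩ := eq_smul_of_mk_eq hWV.symm
  rw [hc, Matrix.det_smul, hV, Fintype.card_fin, mul_one] at hW
  have h2 : (c ^ 2) ^ 2 = 1 := by rw [← hW]; ring
  rw [hc, cartanDouble_smul, Matrix.trace_smul]
  rcases sq_eq_one_iff.1 h2 with h2 | h2 <;> simp [h2, h]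

theorem programs_two_eq : programs cphaseGates 2 = programs czGates 2 := by
  apply Set.Subset.antisymm
  · intro u hu
    exact mem_programs_cz_of_mem_triangle (isMonodromy_monodromy u)
      (mem_triangle_of_mem_programs hu (isMonodromy_monodromy u))
  · exact programs_mono czGates_subset_cphaseGates 2

theorem monodromy_image_programs_two : monodromy '' programs cphaseGates 2 = triangle := by
  apply Set.Subset.antisymm
  · rintro _ ⟨u, hu, rfl⟩
    exact mem_triangle_of_mem_programs hu (isMonodromy_monodromy u)
  · intro a ha
    have h := isMonodromy_magicDiagonal ha.1
    refine ⟨_, ?_, monodromy_eq h⟩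
    rw [programs_two_eq]
    exact mem_programs_cz_of_mem_triangle h ha

/-- Every class in `PU(4)` has a lift to `SU(4)`. -/
theorem exists_smul_det_eq_one (U : U4) : ∃ V : U4, V.1.det = 1 ∧ (V : PU4) = U ∧
    ∃ c : ℂ, V.1 = c • U.1 := by
  obtain ⟨a, -, V, hV, hVU, -⟩ := exists_isMonodromy (U : PU4)
  exact ⟨V, hV, hVU, eq_smul_of_mk_eq hVU.symm⟩

theorem cz_mul_cz : cz * cz = 1 := by
  apply Subtype.ext
  rw [Submonoid.coe_mul, cz, mul_fin_four]
  ext i j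
  fin_cases i <;> fin_cases j <;> simp

/-- Every class is `CZ` times a program with two `CZ` gates, up to local gates: by
`trace_cartanDouble_cz_hadamard` the quotient has Cartan double of trace zero. -/
theorem programs_cz_three : programs czGates 3 = Set.univ := by
  refine Set.eq_univ_of_forall fun u => ?_
  obtain ⟨a, ha, V, hV, rfl, hs⟩ := exists_isMonodromy u
  obtain ⟨l₁, hl₁, l₂, hl₂, hV'⟩ := exists_cartan_decomposition hV ha.1.2.2 hs
  rw [hV']
  refine mul_local_mem_programs hl₂ (local_mul_mem_programs hl₁ ?_)
  set D := magicDiagonal fun j => π * a j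
  obtain ⟨W, hW, hWu, c, hc⟩ := exists_smul_det_eq_one (cz * tensor 1 hadamard * D)
  have hmem : ((cz * tensor 1 hadamard * D : U4) : PU4) ∈ programs czGates 2 := by
    rw [← hWu]
    refine mem_programs_cz_of_trace_real hW ?_
    rw [hc, cartanDouble_smul, Matrix.trace_smul, trace_cartanDouble_cz_hadamard]
    simp
  refine ⟨_, inv_mem_localGates ⟨1, hadamard, rfl⟩, _, rfl, _, hmem, ?_⟩
  rw [← QuotientGroup.mk_inv, ← QuotientGroup.mk_mul, ← QuotientGroup.mk_mul]
  congr 1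
  rw [mul_assoc _ cz, mul_assoc cz, ← mul_assoc cz cz, cz_mul_cz, one_mul, inv_mul_cancel_left]

theorem programs_cphase_three : programs cphaseGates 3 = Set.univ :=
  Set.eq_univ_of_univ_subset
    (programs_cz_three ▸ programs_mono czGates_subset_cphaseGates 3)

/-- The one-qubit gate `diag(1, i)`. -/
def phaseGate : Matrix.unitaryGroup (Fin 2) ℂ :=
  ⟨!![1, 0; 0, Complex.I], by
    rw [Matrix.mem_unitaryGroup_iff]
    ext i j
    fin_cases i <;> fin_cases j <;> simp [Matrix.mul_apply, Matrix.star_apply]⟩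

/-- Up to the local gate `diag(1, i) ⊗ diag(1, i)`, the `iSWAP` gate is `CZ` followed or preceded by
the swap of the two qubits; in a circuit with two `iSWAP` gates the two swaps cancel. -/
theorem iswap_mul_tensor_mul_iswap (A B : Matrix.unitaryGroup (Fin 2) ℂ) :
    iswap * tensor A B * iswap =
      tensor phaseGate phaseGate * cz * tensor B A * cz * tensor phaseGate phaseGate := by
  apply Subtype.ext
  simp only [Submonoid.coe_mul]
  have hP : (tensor phaseGate phaseGate).1 =
      !![1, 0, 0, 0; 0, Complex.I, 0, 0; 0, 0, Complex.I, 0; 0, 0, 0, -1] := by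
    rw [tensor_eq]
    ext i j
    fin_cases i <;> fin_cases j <;> simp [phaseGate]
  rw [hP, tensor_eq, tensor_eq, iswap, cz]
  simp only [mul_fin_four]
  ext i j
  fin_cases i <;> fin_cases j <;> simp <;> ring

theorem programs_iswap_two : programs iswapGates 2 = programs czGates 2 := by
  have h : ∀ A B : Matrix.unitaryGroup (Fin 2) ℂ, ((iswap : U4) : PU4) * (tensor A B : U4) *
      (iswap : U4) = (tensor phaseGate phaseGate : U4) * (cz : U4) * (tensor B A : U4) * (cz : U4) *
        (tensor phaseGate phaseGate : U4) := by
    intro A B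
    simp only [← QuotientGroup.mk_mul, iswap_mul_tensor_mul_iswap]
  have hP : ((tensor phaseGate phaseGate : U4) : PU4) ∈ localGates := ⟨_, _, rfl⟩
  apply Set.Subset.antisymm
  · rintro _ ⟨l, hl, _, rfl, _, ⟨_, ⟨A, B, rfl⟩, _, rfl, k, hk, rfl⟩, rfl⟩
    refine ⟨_, mul_mem_localGates hl hP, _, rfl, _, ⟨_, ⟨B, A, rfl⟩, _, rfl, _,
      mul_mem_localGates hP hk, rfl⟩, ?_⟩
    calc _ = l * (((iswap : U4) : PU4) * (tensor A B : U4) * (iswap : U4)) * k := by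
          simp only [mul_assoc]
      _ = _ := by rw [h]; simp only [mul_assoc]
  · rintro _ ⟨l, hl, _, rfl, _, ⟨_, ⟨A, B, rfl⟩, _, rfl, k, hk, rfl⟩, rfl⟩
    refine ⟨_, mul_mem_localGates hl (inv_mem_localGates hP), _, rfl, _, ⟨_, ⟨B, A, rfl⟩, _, rfl, _,
      mul_mem_localGates (inv_mem_localGates hP) hk, rfl⟩, ?_⟩
    symm
    calc _ = l * ((tensor phaseGate phaseGate : U4) : PU4)⁻¹ * (((iswap : U4) : PU4) *
          (tensor B A : U4) * (iswap : U4)) *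
            (((tensor phaseGate phaseGate : U4) : PU4)⁻¹ * k) := by
          simp only [mul_assoc]
      _ = _ := by rw [h]; group

/-! ### Haar measure and depth -/

instance isClosed_phases : IsClosed (phases : Set U4) := by
  have h : (phases : Set U4) = {U : U4 | U.1 = U.1 0 0 • 1} := by
    ext U
    constructor
    · rintro ⟨c, hc⟩
      have h0 : U.1 0 0 = c := by rw [hc]; simp
      change U.1 = U.1 0 0 • 1
      rw [h0, hc]
    · intro hU
      exact ⟨_, hU⟩
  rw [h]
  have hc : Continuous fun U : U4 => U.1 := by fun_prop
  exact isClosed_eq hc (((continuous_apply_apply 0 0).comp hc).smul continuous_const)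

instance isProbabilityMeasure_haarPU4 : IsProbabilityMeasure haarPU4 :=
  ⟨Measure.haarMeasure_self⟩

instance isMulLeftInvariant_haarPU4 : haarPU4.IsMulLeftInvariant :=
  inferInstanceAs (Measure.haarMeasure _).IsMulLeftInvariant

theorem continuous_trace_cartanDouble :
    Continuous fun V : U4 => (cartanDouble V.1).trace := by
  unfold cartanDouble
  fun_prop

theorem continuous_cartanDouble : Continuous fun V : U4 => cartanDouble V.1 := by
  unfold cartanDouble
  fun_prop

/-- The programs with two `CPHASE` gates are the image of a closed set in the compact group
`U(4)`. -/
theorem programs_two_eq_image : programs cphaseGates 2 =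
    ((↑) : U4 → PU4) '' {V | V.1.det = 1 ∧ (cartanDouble V.1).trace.im = 0} := by
  apply Set.Subset.antisymm
  · intro u hu
    obtain ⟨-, -, V, hV, rfl, -⟩ := exists_isMonodromy u
    exact ⟨V, ⟨hV, trace_real_of_mem_programs hV hu⟩, rfl⟩
  · rintro _ ⟨V, ⟨hV, h⟩, rfl⟩
    rw [programs_two_eq]
    exact mem_programs_cz_of_trace_real hV h

theorem isClosed_programs_two : IsClosed (programs cphaseGates 2) := by
  rw [programs_two_eq_image]
  have hc : Continuous ((↑) : U4 → PU4) := continuous_quot_mk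
  refine IsCompact.isClosed (IsCompact.image (IsClosed.isCompact ?_) hc)
  exact IsClosed.inter (isClosed_eq (by fun_prop) continuous_const)
    (isClosed_eq (Complex.continuous_im.comp continuous_trace_cartanDouble) continuous_const)

/-- A measurable set is Haar null if every orbit of some curve meets it in a countable set of
times: by Fubini its measure is the average over `u` of the times at which the curve through `u`
lies in the set. -/
theorem haarPU4_eq_zero_of_countable {A : Set PU4} (hA : MeasurableSet A) {h : ℝ → PU4}
    (hc : Continuous h) (hh : ∀ u, {t | h t * u ∈ A}.Countable) : haarPU4 A = 0 := by
  set S : Set (ℝ × PU4) := {p | h p.1 * p.2 ∈ A} with hS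
  have hSm : MeasurableSet S := by
    have h1 : Continuous fun p : ℝ × PU4 => h p.1 * p.2 := by fun_prop
    exact h1.measurable hA
  set ν : Measure ℝ := volume.restrict (Set.Icc 0 1) with hν
  have h1 : (ν.prod haarPU4) S = haarPU4 A := by
    rw [Measure.prod_apply hSm]
    have h2 : ∀ t, haarPU4 (Prod.mk t ⁻¹' S) = haarPU4 A := fun t =>
      measure_preimage_mul haarPU4 (h t) A
    simp [h2, hν]
  have h2 : (ν.prod haarPU4) S = 0 := by
    rw [Measure.prod_apply_symm hSm]
    have h3 : ∀ u, ν ((fun t => (t, u)) ⁻¹' S) = 0 := fun u => (hh u).measure_zero ν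
    simp [h3]
  rw [← h1, h2]

theorem countable_exp_eq (y : ℂ) :
    {t : ℝ | Complex.exp ((4 * t : ℝ) * Complex.I) = y}.Countable := by
  rcases Set.eq_empty_or_nonempty {t : ℝ | Complex.exp ((4 * t : ℝ) * Complex.I) = y} with
    h | ⟨s, hs⟩
  · rw [h]; exact Set.countable_empty
  · refine (Set.countable_range fun n : ℤ => s + n * (π / 2)).mono fun t ht => ?_
    obtain ⟨n, hn⟩ := Complex.exp_eq_exp_iff_exists_int.1 (ht.trans hs.symm)
    refine ⟨n, ?_⟩
    have h1 : ((4 * t : ℝ) : ℂ) * Complex.I = ((4 * s + n * (2 * π) : ℝ) : ℂ) * Complex.I := by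
      rw [hn]; push_cast; ring
    have h2 := Complex.ofReal_injective (mul_right_cancel₀ Complex.I_ne_zero h1)
    simp only
    linarith

/-- Multiplied by `2i e^{6it}`, the imaginary part is a cubic polynomial in `e^{4it}` with leading
coefficient `m`. -/
theorem countable_im_eq_zero {m : ℂ} (hm : m ≠ 0) (c : ℂ) :
    {t : ℝ | (Complex.exp ((6 * t : ℝ) * Complex.I) * m +
      Complex.exp ((-2 * t : ℝ) * Complex.I) * c).im = 0}.Countable := by
  set p : Polynomial ℂ := Polynomial.C m * Polynomial.X ^ 3 +
    Polynomial.C (-star c) * Polynomial.X ^ 2 + Polynomial.C c * Polynomial.X +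
    Polynomial.C (-star m) with hp
  have hp0 : p ≠ 0 := by
    intro h0
    have h1 := Polynomial.natDegree_cubic (b := -star c) (c := c) (d := -star m) hm
    rw [← hp, h0] at h1
    simp at h1
  refine ((p.roots.toFinset.countable_toSet).biUnion fun y _ => countable_exp_eq y).mono ?_
  intro t ht
  simp only [Set.mem_iUnion]
  refine ⟨Complex.exp ((4 * t : ℝ) * Complex.I), ?_, rfl⟩
  simp only [Finset.mem_coe, Multiset.mem_toFinset]
  rw [Polynomial.mem_roots hp0, Polynomial.IsRoot, hp]
  simp only [Polynomial.eval_add, Polynomial.eval_mul, Polynomial.eval_C, Polynomial.eval_pow,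
    Polynomial.eval_X]
  -- a complex number is real if it equals its conjugate; clear the denominator `e^{6it}`
  have h1 := Complex.conj_eq_iff_im.2 ht
  rw [map_add, map_mul, map_mul, ← Complex.exp_conj, ← Complex.exp_conj, map_mul, map_mul,
    Complex.conj_ofReal, Complex.conj_ofReal, Complex.conj_I] at h1
  set z := Complex.exp ((2 * t : ℝ) * Complex.I) with hz
  have hz0 : z ≠ 0 := Complex.exp_ne_zero _
  have e6 : Complex.exp ((6 * t : ℝ) * Complex.I) = z ^ 3 := by
    rw [hz, ← Complex.exp_nat_mul]; congr 1; push_cast; ring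
  have e4 : Complex.exp ((4 * t : ℝ) * Complex.I) = z ^ 2 := by
    rw [hz, ← Complex.exp_nat_mul]; congr 1; push_cast; ring
  have e2 : Complex.exp ((-2 * t : ℝ) * Complex.I) = z⁻¹ := by
    rw [hz, ← Complex.exp_neg]; congr 1; push_cast; ring
  have f6 : Complex.exp ((6 * t : ℝ) * -Complex.I) = (z ^ 3)⁻¹ := by
    rw [← e6, ← Complex.exp_neg]; congr 1; push_cast; ring
  have f2 : Complex.exp ((-2 * t : ℝ) * -Complex.I) = z := by
    rw [hz]; congr 1; push_cast; ring
  rw [e6, e2, f6, f2] at h1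
  rw [e4]
  field_simp at h1
  simp only [Complex.star_def]
  linear_combination -h1

theorem magic_conj_tensor_mul_transpose (A B : Matrix.unitaryGroup (Fin 2) ℂ) :
    (magicQᴴ * (tensor A B).1 * magicQ) * (magicQᴴ * (tensor A B).1 * magicQ)ᵀ =
      localDet A B • 1 := by
  calc _ = magicQᴴ * ((tensor A B).1 * (magicQ * magicQᵀ) * (tensor A B).1ᵀ) * magicQᴴᵀ := by
        simp only [Matrix.transpose_mul, Matrix.mul_assoc]
    _ = localDet A B • ((magicQᴴ * magicQ) * (magicQᵀ * magicQᴴᵀ)) := by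
        rw [magicQ_mul_transpose, tensor_spinFlip, ← localDet, ← magicQ_mul_transpose]
        simp only [Matrix.mul_assoc, Matrix.smul_mul, Matrix.mul_smul]
    _ = _ := by rw [magicQ_mul, transpose_magicQ_mul, Matrix.mul_one]

theorem cartanDouble_mul (U V : Matrix (Fin 4) (Fin 4) ℂ) : cartanDouble (U * V) =
    (magicQᴴ * U * magicQ) * cartanDouble V * (magicQᴴ * U * magicQ)ᵀ := by
  rw [cartanDouble, magic_conj_mul, Matrix.transpose_mul, cartanDouble]
  simp only [Matrix.mul_assoc]

theorem cartanDouble_magicDiagonal_mul (θ : Fin 4 → ℝ) (V : Matrix (Fin 4) (Fin 4) ℂ) (j : Fin 4) :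
    cartanDouble ((magicDiagonal θ).1 * V) j j =
      Complex.exp ((2 * θ j : ℝ) * Complex.I) * cartanDouble V j j := by
  rw [cartanDouble_mul, magic_conj_magicDiagonal, Matrix.diagonal_transpose, Matrix.mul_diagonal,
    Matrix.diagonal_mul, mul_right_comm, ← Complex.exp_add]
  congr 2
  push_cast
  ring

/-- The classes of the operators whose Cartan double has a nonzero first entry. -/
def firstEntryNonzero : Set PU4 := ((↑) : U4 → PU4) '' {V | cartanDouble V.1 0 0 ≠ 0}

theorem isOpen_firstEntryNonzero : IsOpen firstEntryNonzero := by
  refine QuotientGroup.isOpenMap_coe _ (isOpen_ne_fun ?_ continuous_const)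
  exact (continuous_apply_apply 0 0).comp continuous_cartanDouble

theorem mk_mem_firstEntryNonzero {V : U4} :
    (V : PU4) ∈ firstEntryNonzero ↔ cartanDouble V.1 0 0 ≠ 0 := by
  refine ⟨?_, fun h => ⟨V, h, rfl⟩⟩
  rintro ⟨W, hW, hWV⟩ h
  obtain ⟨c, hc⟩ := eq_smul_of_mk_eq hWV.symm
  apply hW
  rw [hc, cartanDouble_smul, Matrix.smul_apply, h, smul_zero]

/-- By the Cartan decomposition, a local factor on the left makes the Cartan double diagonal. -/
theorem exists_local_mul_mem_firstEntryNonzero (u : PU4) :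
    ∃ k ∈ localGates, k * u ∈ firstEntryNonzero := by
  obtain ⟨a, ha, V, hV, rfl, hs⟩ := exists_isMonodromy u
  obtain ⟨l₁, hl₁, _, ⟨A, B, rfl⟩, hV'⟩ := exists_cartan_decomposition hV ha.1.2.2 hs
  refine ⟨l₁⁻¹, inv_mem_localGates hl₁, ?_⟩
  rw [hV', mul_assoc, inv_mul_cancel_left, ← QuotientGroup.mk_mul, mk_mem_firstEntryNonzero,
    Submonoid.coe_mul, cartanDouble_magicDiagonal_mul, cartanDouble,
    magic_conj_tensor_mul_transpose]
  simp [localDet_ne_zero]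

/-- The curve with eigenphases `3t, -t, -t, -t` on the magic basis multiplies the first diagonal
entry of the Cartan double by `e^{6it}` and the others by `e^{-2it}`. -/
theorem haarPU4_inter_firstEntryNonzero :
    haarPU4 (programs cphaseGates 2 ∩ firstEntryNonzero) = 0 := by
  refine haarPU4_eq_zero_of_countable
    (isClosed_programs_two.measurableSet.inter isOpen_firstEntryNonzero.measurableSet)
    (h := fun t => (magicDiagonal ![3 * t, -t, -t, -t] : U4)) ?_ fun u => ?_
  · refine continuous_quot_mk.comp (Continuous.subtype_mk ?_ _)
    refine (continuous_const.matrix_mul (Continuous.matrix_diagonal ?_)).matrix_mul continuous_const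
    refine continuous_pi fun j => ?_
    fin_cases j <;> simp <;> fun_prop
  · obtain ⟨-, -, V, hV, rfl, -⟩ := exists_isMonodromy u
    set M := cartanDouble V.1 with hM
    have hdet : ∀ t : ℝ, (magicDiagonal ![3 * t, -t, -t, -t] * V : U4).1.det = 1 := by
      intro t
      rw [Submonoid.coe_mul, Matrix.det_mul, hV, det_magicDiagonal, mul_one]
      simp [Fin.sum_univ_four]
      ring
    by_cases h0 : M 0 0 = 0
    · convert Set.countable_empty
      refine Set.eq_empty_of_forall_notMem fun t ht => ?_
      have h1 := ht.2
      rw [← QuotientGroup.mk_mul, mk_mem_firstEntryNonzero, Submonoid.coe_mul,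
        cartanDouble_magicDiagonal_mul, ← hM, h0, mul_zero] at h1
      exact h1 rfl
    · refine (countable_im_eq_zero h0 (M 1 1 + M 2 2 + M 3 3)).mono fun t ht => ?_
      have h1 := trace_real_of_mem_programs (hdet t) ht.1
      rw [Matrix.trace, Fin.sum_univ_four] at h1
      simp only [Matrix.diag_apply, Submonoid.coe_mul, cartanDouble_magicDiagonal_mul, ← hM] at h1
      rw [Set.mem_ofPred_eq, ← h1]
      congr 1
      simp only [Matrix.cons_val]
      rw [show 2 * (3 * t) = 6 * t by ring, show 2 * -t = -2 * t by ring]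
      ring

theorem haarPU4_programs_two : haarPU4 (programs cphaseGates 2) = 0 := by
  -- finitely many local translates of the open set `firstEntryNonzero` cover the compact group
  obtain ⟨t, ht⟩ := isCompact_univ.elim_finite_subcover
    (fun k : localGates => (fun u => k.1 * u) ⁻¹' firstEntryNonzero)
    (fun k => isOpen_firstEntryNonzero.preimage (continuous_const_mul k.1))
    (fun u _ => by
      obtain ⟨k, hk, hu⟩ := exists_local_mul_mem_firstEntryNonzero u
      exact Set.mem_iUnion.2 ⟨⟨k, hk⟩, hu⟩)
  refine measure_mono_null (t := ⋃ k ∈ t, (fun u => k.1 * u) ⁻¹'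
    (programs cphaseGates 2 ∩ firstEntryNonzero)) ?_ ?_
  · intro u hu
    have h1 := ht (Set.mem_univ u)
    simp only [Set.mem_iUnion] at h1 ⊢
    obtain ⟨k, hk, hku⟩ := h1
    exact ⟨k, hk, local_mul_mem_programs k.2 hu, hku⟩
  · refine (measure_biUnion_null_iff t.countable_toSet).2 fun k _ => ?_
    rw [measure_preimage_mul, haarPU4_inter_firstEntryNonzero]

theorem depth_eq_three {u : PU4} (hu : u ∉ programs cphaseGates 2) : depth cphaseGates u = 3 := by
  have h1 := programs_subset_succ one_mem_cphaseGates
  apply le_antisymm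
  · exact iInf₂_le 3 (by rw [programs_cphase_three]; trivial)
  · refine le_iInf₂ fun n hn => ?_
    by_contra hlt
    have h3 : n < 3 := by exact_mod_cast not_le.1 hlt
    interval_cases n
    · exact hu (h1 1 (h1 0 hn))
    · exact hu (h1 1 hn)
    · exact hu hn

theorem expectedDepthHaar_cphase : expectedDepthHaar cphaseGates = 3 := by
  have h : ∀ᵐ u ∂haarPU4, ((depth cphaseGates u : ℕ∞) : ℝ≥0∞) = 3 := by
    have h0 : ∀ᵐ u ∂haarPU4, u ∉ programs cphaseGates 2 :=
      measure_eq_zero_iff_ae_notMem.1 haarPU4_programs_two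
    filter_upwards [h0] with u hu
    rw [depth_eq_three hu]
    rfl
  rw [expectedDepthHaar, lintegral_congr_ae h]
  simp

/-! ### The volume of the alcove -/

theorem measurableSet_alcoveC2 : MeasurableSet alcoveC2 := by
  have h : alcoveC2 = {a | a 1 ≤ a 0 ∧ a 2 ≤ a 1 ∧ a 3 ≤ a 2 ∧ a 0 - 1 ≤ a 3 ∧
      a 0 + a 1 + a 2 + a 3 = 0 ∧
      (a 0 < a 2 + 1 / 2 ∨ (a 2 + 1 / 2 = a 0 ∧ a 3 + 1 / 2 ≤ a 1))} := by
    ext a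
    simp only [alcoveC2, Set.mem_ofPred_eq, mem_alcove_iff]
    tauto
  rw [h]
  measurability

theorem exists_lipschitzWith_sum {ι : Type*} [Fintype ι] (w : Fin 4 → ι → ℝ) :
    ∃ K, LipschitzWith K (fun x : ι → ℝ => WithLp.toLp 2 fun j => ∑ i, w j i * x i) := by
  let f : (ι → ℝ) →ₗ[ℝ] EuclideanSpace ℝ (Fin 4) :=
    (WithLp.linearEquiv 2 ℝ (Fin 4 → ℝ)).symm.toLinearMap ∘ₗ Matrix.mulVecLin (Matrix.of w)
  exact ⟨_, (LinearMap.toContinuousLinearMap f).lipschitz⟩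

theorem alcove_subset_range : alcoveC2 ⊆
    (fun x : Fin 3 → ℝ => WithLp.toLp 2 fun j =>
      ∑ i, !![1, 0, 0; 0, 1, 0; 0, 0, 1; -1, -1, -1] j i * x i) ''
      Set.Icc (fun _ => -1) (fun _ => 1) := by
  intro a ha
  obtain ⟨h1, h2, h3, h4, h5⟩ := alcove_le ha.1
  refine ⟨![a 0, a 1, a 2], ⟨?_, ?_⟩, ?_⟩
  · intro i
    fin_cases i <;> simp <;> linarith
  · intro i
    fin_cases i <;> simp <;> linarith
  · ext i
    fin_cases i <;> simp [Fin.sum_univ_three]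
    linarith

theorem hausdorffMeasure_three_eq_volume :
    (μH[3] : Measure (Fin 3 → ℝ)) = volume := by
  have h := MeasureTheory.hausdorffMeasure_pi_real (ι := Fin 3)
  simpa using h

theorem hausdorffMeasure_alcoveC2_lt_top : μH[3] alcoveC2 < ∞ := by
  obtain ⟨K, hK⟩ := exists_lipschitzWith_sum !![1, 0, 0; 0, 1, 0; 0, 0, 1; -1, -1, -1]
  refine (measure_mono alcove_subset_range).trans_lt ?_
  refine (hK.hausdorffMeasure_image_le (by norm_num) _).trans_lt ?_
  rw [hausdorffMeasure_three_eq_volume]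
  exact ENNReal.mul_lt_top (by simp) isCompact_Icc.measure_lt_top

theorem hausdorffMeasure_alcoveC2_pos : 0 < μH[3] alcoveC2 := by
  -- the first three coordinates of the points of the alcove contain a box
  have hproj : LipschitzWith 1
      (fun (a : EuclideanSpace ℝ (Fin 4)) (i : Fin 3) => a i.castSucc) := by
    refine LipschitzWith.of_dist_le_mul fun a b => ?_
    rw [NNReal.coe_one, one_mul, dist_pi_le_iff dist_nonneg]
    intro i
    have h := PiLp.norm_apply_le (a - b) i.castSucc
    rwa [PiLp.sub_apply, ← dist_eq_norm, ← dist_eq_norm] at h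
  have hbox : Set.Icc ![1 / 5, 1 / 20, -1 / 20] ![1 / 4, 1 / 10, -1 / 40] ⊆
      (fun (a : EuclideanSpace ℝ (Fin 4)) (i : Fin 3) => a i.castSucc) '' alcoveC2 := by
    rintro x ⟨hl, hu⟩
    have l0 := hl 0
    have l1 := hl 1
    have l2 := hl 2
    have u0 := hu 0
    have u1 := hu 1
    have u2 := hu 2
    simp at l0 l1 l2 u0 u1 u2
    refine ⟨!₂[x 0, x 1, x 2, -(x 0 + x 1 + x 2)], ⟨mem_alcove_iff.2 ?_, Or.inl ?_⟩, ?_⟩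
    · simp
      refine ⟨?_, ?_, ?_, ?_⟩ <;> linarith
    · simp
      linarith
    · funext i
      fin_cases i <;> rfl
  have h := (measure_mono hbox).trans (hproj.hausdorffMeasure_image_le (d := 3) (by norm_num) _)
  refine pos_of_ne_zero fun h0 => ?_
  rw [h0, mul_zero, hausdorffMeasure_three_eq_volume, Real.volume_Icc_pi, Fin.prod_univ_three] at h
  simp only [Matrix.cons_val] at h
  norm_num at h

theorem hausdorffMeasure_triangle : μH[3] triangle = 0 := by
  obtain ⟨K, hK⟩ := exists_lipschitzWith_sum !![1, 0; 0, 1; 0, -1; -1, 0]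
  have hsub : triangle ⊆ Set.range
      (fun x : Fin 2 → ℝ => WithLp.toLp 2 fun j =>
        ∑ i, !![1, 0; 0, 1; 0, -1; -1, 0] j i * x i) := by
    intro a ha
    obtain ⟨-, -, -, h2, h3⟩ := mem_triangle_iff.1 ha
    refine ⟨![a 0, a 1], ?_⟩
    ext i
    fin_cases i <;> simp [h2, h3]
  refine measure_mono_null hsub ?_
  have hdim := hK.dimH_range_le
  rw [Real.dimH_univ_pi_fin] at hdim
  refine hausdorffMeasure_of_dimH_lt (d := 3) (lt_of_le_of_lt hdim ?_)
  norm_num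

theorem alcoveVolume_triangle : alcoveVolume triangle = 0 := by
  have h : (μH[3] : Measure (EuclideanSpace ℝ (Fin 4))).restrict alcoveC2 triangle = 0 :=
    le_antisymm ((Measure.restrict_apply_le _ _).trans hausdorffMeasure_triangle.le) zero_le
  rw [alcoveVolume, Measure.smul_apply, h, smul_zero]

theorem alcoveVolume_univ : alcoveVolume Set.univ = 1 := by
  rw [alcoveVolume, Measure.smul_apply, Measure.restrict_apply_univ, smul_eq_mul,
    ENNReal.inv_mul_cancel hausdorffMeasure_alcoveC2_pos.ne' hausdorffMeasure_alcoveC2_lt_top.ne]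

theorem expectedDepthAlcove_cphase : expectedDepthAlcove cphaseGates = 3 := by
  have h1 : ∀ᵐ x ∂alcoveVolume, x ∈ alcoveC2 :=
    Measure.ae_smul_measure (ae_restrict_mem measurableSet_alcoveC2) _
  have h2 : ∀ᵐ x ∂alcoveVolume, x ∉ triangle :=
    measure_eq_zero_iff_ae_notMem.1 alcoveVolume_triangle
  have h : ∀ᵐ x ∂alcoveVolume,
      ((⨅ (u : PU4) (_ : monodromy u = x), depth cphaseGates u : ℕ∞) : ℝ≥0∞) = 3 := by
    filter_upwards [h1, h2] with x hx hxt
    have h3 : ∀ u, monodromy u = x → depth cphaseGates u = 3 := by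
      rintro u rfl
      refine depth_eq_three fun hu => hxt ?_
      exact mem_triangle_of_mem_programs hu (isMonodromy_monodromy u)
    have h4 : (⨅ (u : PU4) (_ : monodromy u = x), depth cphaseGates u) = 3 := by
      apply le_antisymm
      · have hm := monodromy_eq (isMonodromy_magicDiagonal hx)
        exact (iInf₂_le (f := fun u (_ : monodromy u = x) => depth cphaseGates u) _ hm).trans
          (h3 _ hm).le
      · exact le_iInf₂ fun u hu => (h3 u hu).ge
    rw [h4]
    rfl
  rw [expectedDepthAlcove, lintegral_congr_ae h, lintegral_const, alcoveVolume_univ, mul_one]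

end
end TwoQubit

theorem mainTheorem8 :
    -- the regions `Π(P²)` agree, and they are the triangle
    TwoQubit.monodromy '' TwoQubit.programs TwoQubit.cphaseGates 2 =
        TwoQubit.monodromy '' TwoQubit.programs TwoQubit.czGates 2 ∧
    TwoQubit.monodromy '' TwoQubit.programs TwoQubit.cphaseGates 2 =
        TwoQubit.monodromy '' TwoQubit.programs TwoQubit.iswapGates 2 ∧
    TwoQubit.monodromy '' TwoQubit.programs TwoQubit.cphaseGates 2 = TwoQubit.triangle ∧
    TwoQubit.triangle = convexHull ℝ
        {!₂[0, 0, 0, 0], !₂[1 / 4, 1 / 4, -1 / 4, -1 / 4], !₂[1 / 2, 0, 0, -1 / 2]} ∧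
    -- the sets of programs agree
    TwoQubit.programs TwoQubit.cphaseGates 2 = TwoQubit.programs TwoQubit.czGates 2 ∧
    TwoQubit.programs TwoQubit.cphaseGates 3 = TwoQubit.programs TwoQubit.czGates 3 ∧
    -- zero volume, in both senses
    TwoQubit.haarPU4 (TwoQubit.programs TwoQubit.cphaseGates 2) = 0 ∧
    TwoQubit.alcoveVolume (TwoQubit.monodromy '' TwoQubit.programs TwoQubit.cphaseGates 2) = 0 ∧
    -- expected depth, in both senses
    TwoQubit.expectedDepthHaar TwoQubit.cphaseGates = 3 ∧
    TwoQubit.expectedDepthAlcove TwoQubit.cphaseGates = 3 := by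
  refine ⟨by rw [TwoQubit.programs_two_eq],
    by rw [TwoQubit.programs_two_eq, TwoQubit.programs_iswap_two],
    TwoQubit.monodromy_image_programs_two, TwoQubit.triangle_eq_convexHull,
    TwoQubit.programs_two_eq, TwoQubit.programs_cphase_three.trans TwoQubit.programs_cz_three.symm,
    TwoQubit.haarPU4_programs_two, ?_, TwoQubit.expectedDepthHaar_cphase,
    TwoQubit.expectedDepthAlcove_cphase⟩
  rw [TwoQubit.monodromy_image_programs_two, TwoQubit.alcoveVolume_triangle]
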